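/- Let $N\ge 0$ and $\beta\ge 1$ be integers and $\omega>0$ a real number. Let $P$ be the space of complex polynomials in commuting variables $x_1,\dots,x_N$ and anticommuting variables $\theta_1,\dots,\theta_N$. For $\sigma\in S_N$ let $\mathcal K_\sigma$ act on $P$ by $x_i\mapsto x_{\sigma(i)}$, $\theta_i\mapsto\theta_{\sigma(i)}$ simultaneously, let $P^{S_N}$ be the subspace of invariants, and let $K_{jk}$ exchange only $x_j$ and $x_k$. A superpartition is a sequence $\Lambda=(\Lambda_1,\dots,\Lambda_m;\Lambda_{m+1},\dots,\Lambda_N)$ of non-negative integers, $0\le m\le N$, with $\Lambda_1>\dots>\Lambda_m$ and $\Lambda_{m+1}\ge\dots\ge\Lambda_N$; $m$ is its fermion number, $|\Lambda|=\sum_i\Lambda_i$, and $\Lambda^*$ is the non-increasing rearrangement of its entries. For $\Omega,\Lambda$ of the same degree and the same fermion number write $\Omega\le\Lambda$ if either $\Omega^*<\Lambda^*$ in the dominance order of partitions, or $\Omega^*=\Lambda^*$ and $\Omega_1+\dots+\Omega_k\le\Lambda_1+\dots+\Lambda_k$ for all $k$. Write $\Omega\le_u\Lambda$ if $\Omega=\Lambda$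 or $|\Omega|=|\Lambda|-2n$ for some integer $n\ge1$ (with no condition on fermion numbers). Let $m_\Lambda=f_\Lambda^{-1}\sum_{\sigma\in S_N}\mathcal K_\sigma(\theta_1\cdots\theta_m x_1^{\Lambda_1}\cdots x_N^{\Lambda_N})$, where $f_\Lambda=\prod_{a\ge0}n(a)!$ and $n(a)$ is the number of $a$'s among $\Lambda_{m+1},\dots,\Lambda_N$. Let $$\langle A,B\rangle_\beta=\prod_j\Big(\frac1{2\pi i}\oint\frac{dx_j}{x_j}\int d\theta_j\,\theta_j\Big)\Big[\prod_{k\ne l}\Big(1-\frac{x_k}{x_l}\Big)^{\beta}A^*B\Big]$$ over the unit torus, with $x_j^*=1/x_j$ and $(\theta_{i_1}\cdots\theta_{i_r})^*\theta_{i_1}\cdots\theta_{i_r}=1$; that is, writing $A=\sum_I\theta_IA_I(x)$ and $B=\sum_I\theta_IB_I(x)$, $\theta$-integration replaces $A^*B$ by $\sum_I\overline{A_I}B_I$. The Jack superpolynomials $J_\Lambda$ are the mutually orthogonal elements of $P^{S_N}$ of the form $J_\Lambda=m_\Lambda+\sum_{\Omega<\Lambda}t_{\Lambda\Omega}m_\Omega$;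 equivalently, $J_\Lambda$ is the unique superpolynomial of this form orthogonal to every $m_\Omega$ with $\Omega<\Lambda$. Let $D_j=\partial_{x_j}+\beta\sum_{k\ne j}\frac1{x_j-x_k}(1-K_{jk})$, $D_j^\dagger=2\omega x_j-D_j$, $\Delta=\sum_jD_j^2$, $$\mathcal D_j^\omega=\frac1{2\omega}D_j^\dagger D_j+\beta\sum_{k>j}K_{jk}-\beta(N-1),\qquad \mathcal H_1^\omega=\sum_{j=1}^N\mathcal D_j^\omega+\frac{\beta N(N-1)}2$$ (the constant makes $\mathcal H_1^\omega 1=0$), and let $J_\Lambda^\omega=e^{-\Delta/(4\omega)}J_\Lambda$ be the generalized Hermite superpolynomials. **Theorem.** The family $(J_\Lambda^\omega)_\Lambda$, indexed by all superpartitions with $N$ entries, is the unique basis of $P^{S_N}$ such that for every $\Lambda$ $$\mathcal H_1^\omega J_\Lambda^\omega=|\Lambda|\,J_\Lambda^\omega\qquad\text{and}\qquad J_\Lambda^\omega=J_\Lambda+\sum_{\Omega<_u\Lambda}w_{\Lambda\Omega}\,J_\Omega$$ for some coefficients $w_{\Lambda\Omega}=w_{\Lambda\Omega}(\beta,\omega,N)$.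 -/

import Mathlib

open MvPolynomial MeasureTheory

noncomputable section

namespace SuperCMS

/-! ### Superpolynomials -/

/-- The space `P` of polynomials in the commuting variables `x_0, …, x_{N-1}` and the
anticommuting variables `θ_0, …, θ_{N-1}`, with complex coefficients.  The family `F` stands for
`∑_I θ_I F_I(x)`, where `θ_I = θ_{i_1} ⋯ θ_{i_m}` for `I = {i_1 < ⋯ < i_m}`; the `θ_I` form a
basis of the Grassmann algebra. -/
abbrev SuperPoly (N : ℕ) : Type := Finset (Fin N) → MvPolynomial (Fin N) ℂ

/-- The number of inversions of `σ` on `I`. -/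
def inversions {N : ℕ} (σ : Equiv.Perm (Fin N)) (I : Finset (Fin N)) : ℕ :=
  ((I ×ˢ I).filter fun p => p.1 < p.2 ∧ σ p.2 < σ p.1).card

/-- The action `𝒦_σ` of a permutation on superpolynomials, `x_i ↦ x_{σ i}` and `θ_i ↦ θ_{σ i}`
simultaneously.  On the odd part
`θ_{σ i_1} ⋯ θ_{σ i_m} = (-1)^{inversions σ I} θ_{σ(I)}` for `I = {i_1 < ⋯ < i_m}`. -/
def permAction {N : ℕ} (σ : Equiv.Perm (Fin N)) : SuperPoly N →ₗ[ℂ] SuperPoly N where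
  toFun F := fun J =>
    (-1 : ℂ) ^ inversions σ (J.map σ.symm.toEmbedding) •
      rename σ (F (J.map σ.symm.toEmbedding))
  map_add' F G := by
    funext J
    simp [smul_add]
  map_smul' c F := by
    funext J
    simp [smul_comm c]

/-- The space `P^{S_N}` of superpolynomials `F` such that `𝒦_{ij} F = F` for all `i, j`. -/
def symmetricSubspace (N : ℕ) : Submodule ℂ (SuperPoly N) where
  carrier := {F | ∀ i j : Fin N, permAction (Equiv.swap i j) F = F}
  add_mem' hF hG i j := by rw [map_add, hF i j, hG i j]
  zero_mem' i j := map_zero _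
  smul_mem' c F hF i j := by rw [map_smul, hF i j]

/-! ### Superpartitions -/

/-- Superpartitions `Λ = (Λ_1, …, Λ_m; Λ_{m+1}, …, Λ_N)`: the first `m` entries are strictly
decreasing and the last `N - m` entries are weakly decreasing. -/
@[ext]
structure Superpartition (N : ℕ) where
  /-- The fermion number. -/
  m : ℕ
  /-- The entries (indexed from `0`). -/
  part : Fin N → ℕ
  m_le : m ≤ N
  strict : ∀ i j : Fin N, i < j → (j : ℕ) < m → part j < part i
  weak : ∀ i j : Fin N, m ≤ (i : ℕ) → i < j → part j ≤ part i

namespace Superpartition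

variable {N : ℕ}

/-- The degree `|Λ|`. -/
def degree (Λ : Superpartition N) : ℕ := ∑ i, Λ.part i

/-- The composition `Λ_c = (Λ_1, …, Λ_N)`. -/
def comp (Λ : Superpartition N) : List ℕ := List.ofFn Λ.part

/-- The partition `Λ^*`: the entries of `Λ` in non-increasing order. -/
def star (Λ : Superpartition N) : List ℕ := (Λ.comp : Multiset ℕ).sort (· ≥ ·)

end Superpartition

/-- `a_1 + ⋯ + a_k ≤ b_1 + ⋯ + b_k` for all `k`. -/
def PartialSumsLE (a b : List ℕ) : Prop := ∀ k : ℕ, (a.take k).sum ≤ (b.take k).sum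

/-- The dominance ordering on superpartitions of the same degree and the same fermion number:
`Ω ≤ Λ` if `Ω^* < Λ^*` in the dominance ordering of partitions, or `Ω^* = Λ^*` and the partial
sums of the composition `Ω_c` are at most those of `Λ_c`. -/
def dominanceLE {N : ℕ} (Ω Λ : Superpartition N) : Prop :=
  Ω.m = Λ.m ∧ Ω.degree = Λ.degree ∧
    ((Ω.star ≠ Λ.star ∧ PartialSumsLE Ω.star Λ.star) ∨
      (Ω.star = Λ.star ∧ PartialSumsLE Ω.comp Λ.comp))

/-- The strict dominance ordering. -/
def dominanceLT {N : ℕ} (Ω Λ : Superpartition N) : Prop := dominanceLE Ω Λ ∧ Ω ≠ Λ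

/-- The `u`-ordering: `Ω ≤_u Λ` if `Ω = Λ` or `|Ω| = |Λ| - 2n` for some `n = 1, 2, 3, …`. -/
def uLE {N : ℕ} (Ω Λ : Superpartition N) : Prop :=
  Ω = Λ ∨ ∃ n : ℕ, 1 ≤ n ∧ Ω.degree + 2 * n = Λ.degree

/-- The strict `u`-ordering. -/
def uLT {N : ℕ} (Ω Λ : Superpartition N) : Prop := uLE Ω Λ ∧ Ω ≠ Λ

/-! ### Supermonomials -/

/-- The superpolynomial `θ_1 ⋯ θ_m x^Λ`. -/
def leadingTerm {N : ℕ} (Λ : Superpartition N) : SuperPoly N :=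
  Pi.single (Finset.univ.filter fun i : Fin N => (i : ℕ) < Λ.m) (∏ i, X i ^ Λ.part i)

/-- `f_Λ = ∏_a n(a)!`, where `n(a)` is the number of entries of the symmetric part
`(Λ_{m+1}, …, Λ_N)` that are equal to `a`. -/
def multiplicityFactor {N : ℕ} (Λ : Superpartition N) : ℕ :=
  ∏ a ∈ Finset.range (Λ.degree + 1),
    (Finset.univ.filter fun i : Fin N => Λ.m ≤ (i : ℕ) ∧ Λ.part i = a).card.factorial

/-- The monomial symmetric superfunction
`m_Λ = f_Λ⁻¹ ∑_σ 𝒦_σ (θ_1 ⋯ θ_m x^Λ)`. -/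
def superMonomial {N : ℕ} (Λ : Superpartition N) : SuperPoly N :=
  (multiplicityFactor Λ : ℂ)⁻¹ • ∑ σ : Equiv.Perm (Fin N), permAction σ (leadingTerm Λ)

/-! ### The scalar product of the trigonometric model -/

/-- The scalar product
`⟨A, B⟩_β = ∏_j (1/(2πi) ∮ dx_j/x_j ∫ dθ_j θ_j) [∏_{k ≠ l} (1 - x_k/x_l)^β A^* B]`
over the unit torus.  Since `(θ_I)^* θ_I = 1`, the Berezin integration of `A^* B` leaves
`∑_I conj(A_I(x)) B_I(x)`; on the torus `x_j^* = 1/x_j` is the complex conjugate of `x_j`. -/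
def scalarProduct {N : ℕ} (β : ℕ) (A B : SuperPoly N) : ℂ :=
  (2 * (Real.pi : ℂ) * Complex.I)⁻¹ ^ N *
    torusIntegral
      (fun x : Fin N → ℂ =>
        (∏ j, (x j)⁻¹) * ((∏ k, ∏ l ∈ {k}ᶜ, (1 - x k / x l) ^ β) *
          ∑ I, (starRingEnd ℂ) (eval x (A I)) * eval x (B I)))
      0 (fun _ => 1)

/-! ### Rational Dunkl operators -/

theorem sub_dvd_sub_rename_swap {N : ℕ} (j k : Fin N) (f : MvPolynomial (Fin N) ℂ) :
    (X j - X k : MvPolynomial (Fin N) ℂ) ∣ f - rename (Equiv.swap j k) f := by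
  have key : (Ideal.Quotient.mkₐ ℂ (Ideal.span {(X j - X k : MvPolynomial (Fin N) ℂ)})) =
      (Ideal.Quotient.mkₐ ℂ (Ideal.span {(X j - X k : MvPolynomial (Fin N) ℂ)})).comp
        (rename (Equiv.swap j k)) := by
    have h : Ideal.Quotient.mk (Ideal.span {(X j - X k : MvPolynomial (Fin N) ℂ)}) (X j) =
        Ideal.Quotient.mk _ (X k) :=
      Ideal.Quotient.eq.mpr (Ideal.mem_span_singleton_self _)
    refine MvPolynomial.algHom_ext fun i => ?_
    simp only [Ideal.Quotient.mkₐ_eq_mk, AlgHom.comp_apply, rename_X]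
    rcases eq_or_ne i j with rfl | hj
    · simpa using h
    · rcases eq_or_ne i k with rfl | hk
      · simpa using h.symm
      · rw [Equiv.swap_apply_of_ne_of_ne hj hk]
  have := DFunLike.congr_fun key f
  simp only [Ideal.Quotient.mkₐ_eq_mk, AlgHom.comp_apply] at this
  exact Ideal.mem_span_singleton.mp (Ideal.Quotient.eq.mp this)

/-- The operator `(x_j - x_k)⁻¹ (1 - K_{jk})` on polynomials, for `j ≠ k` (and `0` if `j = k`),
where `K_{jk}` exchanges `x_j` and `x_k`. -/
def dividedDifference {N : ℕ} (j k : Fin N) (f : MvPolynomial (Fin N) ℂ) :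
    MvPolynomial (Fin N) ℂ :=
  if j = k then 0 else (sub_dvd_sub_rename_swap j k f).choose

theorem mul_dividedDifference {N : ℕ} {j k : Fin N} (h : j ≠ k) (f : MvPolynomial (Fin N) ℂ) :
    (X j - X k) * dividedDifference j k f = f - rename (Equiv.swap j k) f := by
  rw [dividedDifference, if_neg h]
  exact (sub_dvd_sub_rename_swap j k f).choose_spec.symm

theorem X_sub_X_ne_zero {N : ℕ} {j k : Fin N} (h : j ≠ k) :
    (X j - X k : MvPolynomial (Fin N) ℂ) ≠ 0 :=
  sub_ne_zero.mpr fun e => h (X_injective e)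

/-- `dividedDifference` as a linear map. -/
def dividedDifferenceₗ {N : ℕ} (j k : Fin N) :
    MvPolynomial (Fin N) ℂ →ₗ[ℂ] MvPolynomial (Fin N) ℂ where
  toFun := dividedDifference j k
  map_add' f g := by
    by_cases h : j = k
    · simp [dividedDifference, h]
    · apply mul_left_cancel₀ (X_sub_X_ne_zero h)
      rw [mul_add]
      simp only [mul_dividedDifference h, map_add]
      ring
  map_smul' c f := by
    by_cases h : j = k
    · simp [dividedDifference, h]
    · apply mul_left_cancel₀ (X_sub_X_ne_zero h)
      rw [RingHom.id_apply, mul_smul_comm]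
      simp only [mul_dividedDifference h, map_smul, smul_sub]

/-- The exchange operator `K_{jk}` on polynomials in `x`. -/
def exchange {N : ℕ} (j k : Fin N) : Module.End ℂ (MvPolynomial (Fin N) ℂ) :=
  (rename (Equiv.swap j k)).toLinearMap

/-- Multiplication by `x_j`. -/
def mulX {N : ℕ} (j : Fin N) : Module.End ℂ (MvPolynomial (Fin N) ℂ) :=
  LinearMap.mulLeft ℂ (X j)

/-- The rational Dunkl operator `D_j = ∂_j + β ∑_{k ≠ j} (x_j - x_k)⁻¹ (1 - K_{jk})`. -/
def dunkl {N : ℕ} (β : ℕ) (j : Fin N) : Module.End ℂ (MvPolynomial (Fin N) ℂ) :=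
  (pderiv j).toLinearMap + (β : ℂ) • ∑ k ∈ {j}ᶜ, dividedDifferenceₗ j k

/-- `D_j^† = 2 ω x_j - D_j`. -/
def dunklAdjoint {N : ℕ} (β : ℕ) (ω : ℝ) (j : Fin N) :
    Module.End ℂ (MvPolynomial (Fin N) ℂ) :=
  (2 * (ω : ℂ)) • mulX j - dunkl β j

/-- `𝒟_j^ω = (2ω)⁻¹ D_j^† D_j + β ∑_{k > j} K_{jk} - β (N - 1)`. -/
def omegaDunkl {N : ℕ} (β : ℕ) (ω : ℝ) (j : Fin N) :
    Module.End ℂ (MvPolynomial (Fin N) ℂ) :=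
  (2 * (ω : ℂ))⁻¹ • (dunklAdjoint β ω j * dunkl β j) +
    (β : ℂ) • ∑ k ∈ Finset.Ioi j, exchange j k - ((β : ℂ) * ((N : ℂ) - 1)) • 1

/-- The action on superpolynomials of an operator on polynomials in `x`: it commutes with the
`θ_i`, so it acts on each coefficient `F_I(x)` of `∑_I θ_I F_I(x)`. -/
def onSuper {N : ℕ} (T : Module.End ℂ (MvPolynomial (Fin N) ℂ)) :
    Module.End ℂ (SuperPoly N) :=
  T.compLeft (Finset (Fin N))

/-- The Hamiltonian `H_1^ω = ∑_j 𝒟_j^ω + β N (N - 1) / 2`, normalised by its additive constant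
in such a way that `H_1^ω 1 = 0`. -/
def hamiltonian (N β : ℕ) (ω : ℝ) : Module.End ℂ (SuperPoly N) :=
  onSuper (∑ j, omegaDunkl β ω j) + ((β : ℂ) * (N : ℂ) * ((N : ℂ) - 1) / 2) • 1

/-- `Δ = ∑_j D_j²`. -/
def laplacian (N β : ℕ) : Module.End ℂ (SuperPoly N) :=
  onSuper (∑ j, dunkl β j ^ 2)

/-- `e^{-Δ/(4ω)} F = ∑_n (n!)⁻¹ (-1/(4ω))^n Δ^n F`; only finitely many terms are non-zero, because
`Δ` lowers the degree in `x` by two. -/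
def expLaplacian {N : ℕ} (β : ℕ) (ω : ℝ) (F : SuperPoly N) : SuperPoly N :=
  ∑ᶠ n : ℕ, ((n.factorial : ℂ)⁻¹ * (-1 / (4 * (ω : ℂ))) ^ n) • (laplacian N β ^ n) F

/-! ### Positive definiteness of the scalar product -/

/-- The point `(e^{iφ_1}, …, e^{iφ_N})` of the unit torus. -/
def torusPoint {N : ℕ} (φ : Fin N → ℝ) : Fin N → ℂ := fun i => Complex.exp (φ i * Complex.I)

theorem torusPoint_ne_zero {N : ℕ} (φ : Fin N → ℝ) (i : Fin N) : torusPoint φ i ≠ 0 :=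
  Complex.exp_ne_zero _

theorem conj_torusPoint {N : ℕ} (φ : Fin N → ℝ) (i : Fin N) :
    (starRingEnd ℂ) (torusPoint φ i) = (torusPoint φ i)⁻¹ := by
  simp [torusPoint, ← Complex.exp_conj, ← Complex.exp_neg]

/-- The weight `∏_{k < l} |1 - x_l/x_k|^{2β}` on the torus. -/
def torusWeight {N : ℕ} (β : ℕ) (φ : Fin N → ℝ) : ℝ :=
  ∏ k, ∏ l ∈ Finset.Ioi k, Complex.normSq (1 - torusPoint φ l / torusPoint φ k) ^ β

theorem torusWeight_nonneg {N : ℕ} (β : ℕ) (φ : Fin N → ℝ) : 0 ≤ torusWeight β φ :=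
  Finset.prod_nonneg fun _ _ => Finset.prod_nonneg fun _ _ => pow_nonneg (Complex.normSq_nonneg _) _

theorem torusWeight_eq {N : ℕ} (β : ℕ) (φ : Fin N → ℝ) :
    (torusWeight β φ : ℂ) =
      ∏ k, ∏ l ∈ {k}ᶜ, (1 - torusPoint φ k / torusPoint φ l) ^ β := by
  have h := Finset.prod_prod_Ioi_mul_eq_prod_prod_off_diag
    (fun k l : Fin N => (1 - torusPoint φ l / torusPoint φ k) ^ β)
  rw [torusWeight]
  push_cast
  have e : ∀ k l : Fin N, ((Complex.normSq (1 - torusPoint φ l / torusPoint φ k) : ℝ) : ℂ) ^ β =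
      (1 - torusPoint φ k / torusPoint φ l) ^ β * (1 - torusPoint φ l / torusPoint φ k) ^ β := by
    intro k l
    rw [Complex.normSq_eq_conj_mul_self, mul_pow]
    congr 2
    simp only [map_sub, map_one, map_div₀, conj_torusPoint]
    rw [inv_div_inv]
  simp_rw [e, h]

theorem scalarProduct_eq {N : ℕ} (β : ℕ) (A B : SuperPoly N) :
    scalarProduct β A B = ((2 * (Real.pi : ℂ)) ^ N)⁻¹ *
      ∫ φ in Set.Icc (0 : Fin N → ℝ) (fun _ => 2 * Real.pi), (torusWeight β φ : ℂ) *
        ∑ I, (starRingEnd ℂ) (eval (torusPoint φ) (A I)) * eval (torusPoint φ) (B I) := by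
  have hm : ∀ φ : Fin N → ℝ, torusMap (0 : Fin N → ℂ) (fun _ => 1) φ = torusPoint φ := by
    intro φ; funext i; simp [torusMap, torusPoint]
  rw [scalarProduct, torusIntegral]
  have : ∀ φ : Fin N → ℝ, ∀ z : ℂ,
      (∏ i : Fin N, ((1 : ℝ) : ℂ) * Complex.exp (φ i * Complex.I) * Complex.I) •
        ((∏ j, (torusPoint φ j)⁻¹) * z) = Complex.I ^ N * z := by
    intro φ z
    rw [smul_eq_mul, ← mul_assoc, ← Finset.prod_mul_distrib]
    congr 1
    rw [Finset.prod_congr rfl (g := fun _ => Complex.I)]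
    · simp
    · intro i _
      have := torusPoint_ne_zero φ i
      rw [torusPoint] at this ⊢
      field_simp
      simp
  simp only [hm, this, ← torusWeight_eq]
  rw [integral_const_mul, ← mul_assoc]
  congr 1
  rw [inv_pow, mul_pow, mul_inv, mul_assoc, inv_mul_cancel₀ (pow_ne_zero _ Complex.I_ne_zero),
    mul_one]

theorem continuous_torusPoint {N : ℕ} : Continuous (torusPoint (N := N)) := by
  unfold torusPoint; fun_prop

theorem continuous_eval_torusPoint {N : ℕ} (p : MvPolynomial (Fin N) ℂ) :
    Continuous fun φ : Fin N → ℝ => eval (torusPoint φ) p :=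
  (MvPolynomial.continuous_eval p).comp continuous_torusPoint

theorem continuous_torusWeight {N : ℕ} (β : ℕ) : Continuous (torusWeight (N := N) β) := by
  unfold torusWeight
  refine continuous_finsetProd _ fun k _ => continuous_finsetProd _ fun l _ => ?_
  refine (Complex.continuous_normSq.comp (continuous_const.sub ?_)).pow _
  exact ((continuous_apply l).comp continuous_torusPoint).div
    ((continuous_apply k).comp continuous_torusPoint) fun φ => torusPoint_ne_zero φ k

theorem continuous_integrand {N : ℕ} (β : ℕ) (A B : SuperPoly N) :
    Continuous fun φ : Fin N → ℝ => (torusWeight β φ : ℂ) *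
      ∑ I, (starRingEnd ℂ) (eval (torusPoint φ) (A I)) * eval (torusPoint φ) (B I) := by
  refine (Complex.continuous_ofReal.comp (continuous_torusWeight β)).mul ?_
  refine continuous_finsetSum _ fun I _ => ?_
  exact (Complex.continuous_conj.comp (continuous_eval_torusPoint _)).mul
    (continuous_eval_torusPoint _)

theorem integrable_integrand {N : ℕ} (β : ℕ) (A B : SuperPoly N) :
    IntegrableOn (fun φ : Fin N → ℝ => (torusWeight β φ : ℂ) *
      ∑ I, (starRingEnd ℂ) (eval (torusPoint φ) (A I)) * eval (torusPoint φ) (B I))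
      (Set.Icc (0 : Fin N → ℝ) (fun _ => 2 * Real.pi)) :=
  (continuous_integrand β A B).continuousOn.integrableOn_compact isCompact_Icc

theorem scalarProduct_conj {N : ℕ} (β : ℕ) (A B : SuperPoly N) :
    (starRingEnd ℂ) (scalarProduct β B A) = scalarProduct β A B := by
  rw [scalarProduct_eq, scalarProduct_eq, map_mul, ← integral_conj]
  congr 1
  · rw [map_inv₀, map_pow, map_mul, Complex.conj_ofReal, Complex.conj_ofNat]
  · congr 1
    funext φ
    simp [mul_comm]

theorem scalarProduct_add_left {N : ℕ} (β : ℕ) (A B C : SuperPoly N) :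
    scalarProduct β (A + B) C = scalarProduct β A C + scalarProduct β B C := by
  simp only [scalarProduct_eq]
  rw [← mul_add, ← integral_add (integrable_integrand β A C) (integrable_integrand β B C)]
  simp [← mul_add, ← Finset.sum_add_distrib, add_mul]

theorem scalarProduct_smul_left {N : ℕ} (β : ℕ) (A B : SuperPoly N) (r : ℂ) :
    scalarProduct β (r • A) B = (starRingEnd ℂ) r * scalarProduct β A B := by
  simp only [scalarProduct_eq]
  rw [mul_left_comm]
  congr 1
  rw [← integral_const_mul]
  congr 1
  funext φ
  simp only [Pi.smul_apply, smul_eval, map_mul, Finset.mul_sum]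
  exact Finset.sum_congr rfl fun _ _ => by ring

theorem scalarProduct_self {N : ℕ} (β : ℕ) (A : SuperPoly N) :
    scalarProduct β A A = ((((2 * Real.pi) ^ N)⁻¹ *
      ∫ φ in Set.Icc (0 : Fin N → ℝ) (fun _ => 2 * Real.pi), torusWeight β φ *
        ∑ I, Complex.normSq (eval (torusPoint φ) (A I)) : ℝ) : ℂ) := by
  rw [scalarProduct_eq]
  push_cast
  rw [← integral_complex_ofReal]
  congr 2
  funext φ
  simp [Complex.normSq_eq_conj_mul_self]

theorem scalarProduct_self_nonneg {N : ℕ} (β : ℕ) (A : SuperPoly N) :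
    0 ≤ (scalarProduct β A A).re := by
  rw [scalarProduct_self, Complex.ofReal_re]
  refine mul_nonneg (by positivity) (integral_nonneg fun φ => ?_)
  exact mul_nonneg (torusWeight_nonneg β φ) (Finset.sum_nonneg fun _ _ => Complex.normSq_nonneg _)

theorem torusWeight_ne_zero {N : ℕ} (β : ℕ) (φ : Fin N → ℝ)
    (h : ∀ k l : Fin N, k ≠ l → torusPoint φ k ≠ torusPoint φ l) : torusWeight β φ ≠ 0 := by
  refine Finset.prod_ne_zero_iff.mpr fun k _ => Finset.prod_ne_zero_iff.mpr fun l hl => ?_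
  refine pow_ne_zero _ fun h0 => ?_
  have h1 := Complex.normSq_eq_zero.mp h0
  have h2 : torusPoint φ l / torusPoint φ k = 1 := (sub_eq_zero.mp h1).symm
  rw [div_eq_one_iff_eq (torusPoint_ne_zero φ k)] at h2
  exact h l k (Finset.mem_Ioi.mp hl).ne' h2

theorem scalarProduct_definite {N : ℕ} (β : ℕ) (A : SuperPoly N)
    (h : scalarProduct β A A = 0) : A = 0 := by
  rw [scalarProduct_self, Complex.ofReal_eq_zero] at h
  have h2 := (mul_eq_zero.mp h).resolve_left (by positivity)
  have hc : Continuous fun φ : Fin N → ℝ => torusWeight β φ *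
      ∑ I, Complex.normSq (eval (torusPoint φ) (A I)) :=
    (continuous_torusWeight β).mul (continuous_finsetSum _ fun I _ =>
      Complex.continuous_normSq.comp (continuous_eval_torusPoint _))
  rw [integral_eq_zero_iff_of_nonneg (fun φ => mul_nonneg (torusWeight_nonneg β φ)
    (Finset.sum_nonneg fun _ _ => Complex.normSq_nonneg _))
    (hc.continuousOn.integrableOn_compact isCompact_Icc)] at h2
  have hopen : IsOpen (Set.pi Set.univ fun _ : Fin N => Set.Ioo 0 (2 * Real.pi)) :=
    isOpen_set_pi Set.finite_univ fun _ _ => isOpen_Ioo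
  have hsub : (Set.pi Set.univ fun _ : Fin N => Set.Ioo 0 (2 * Real.pi)) ⊆
      Set.Icc (0 : Fin N → ℝ) (fun _ => 2 * Real.pi) := fun φ hφ =>
    ⟨fun i => (hφ i trivial).1.le, fun i => (hφ i trivial).2.le⟩
  have h3 := Measure.eqOn_open_of_ae_eq (ae_restrict_of_ae_restrict_of_subset hsub h2) hopen
    hc.continuousOn continuousOn_const
  funext I
  have hprod : A I * ∏ k : Fin N, ∏ l ∈ {k}ᶜ, (X k - X l) = 0 := by
    refine MvPolynomial.funext_set
      (fun _ : Fin N => (fun t : ℝ => Complex.exp (t * Complex.I)) '' Set.Ioo 0 (2 * Real.pi))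
      (hs := ?_) ?_
    · intro i
      refine ((Set.Ioo_infinite (by positivity)).image ?_)
      intro s hs t ht hst
      have hinj := Complex.exp_inj_of_neg_pi_lt_of_le_pi (x := (s - Real.pi) * Complex.I)
        (y := (t - Real.pi) * Complex.I)
      have hh : ((s : ℂ) - Real.pi) * Complex.I = ((t : ℂ) - Real.pi) * Complex.I := by
        refine hinj ?_ ?_ ?_ ?_ ?_
        · simp; linarith [hs.1]
        · simp; linarith [hs.2]
        · simp; linarith [ht.1]
        · simp; linarith [ht.2]
        · rw [sub_mul, sub_mul, Complex.exp_sub, Complex.exp_sub]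
          congr 1
      have := mul_right_cancel₀ Complex.I_ne_zero hh
      exact_mod_cast sub_left_injective this
    · intro x hx
      choose φ hφ hφx using fun i => hx i trivial
      have hx' : x = torusPoint φ := funext fun i => (hφx i).symm
      subst hx'
      rw [map_mul, map_zero]
      by_cases hd : ∀ k l : Fin N, k ≠ l → torusPoint φ k ≠ torusPoint φ l
      · have h4 : torusWeight β φ * _ = 0 := h3 (fun i _ => hφ i)
        have h5 := (mul_eq_zero.mp h4).resolve_left (torusWeight_ne_zero β φ hd)
        rw [Finset.sum_eq_zero_iff_of_nonneg fun _ _ => Complex.normSq_nonneg _] at h5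
        rw [Complex.normSq_eq_zero.mp (h5 I (Finset.mem_univ _)), zero_mul]
      · push Not at hd
        obtain ⟨k, l, hkl, he⟩ := hd
        refine mul_eq_zero_of_right _ ?_
        rw [map_prod]
        refine Finset.prod_eq_zero (Finset.mem_univ k) ?_
        rw [map_prod]
        exact Finset.prod_eq_zero (i := l) (by simpa using hkl.symm) (by simp [he])
  refine (mul_eq_zero.mp hprod).resolve_right ?_
  refine Finset.prod_ne_zero_iff.mpr fun k _ => Finset.prod_ne_zero_iff.mpr fun l hl => ?_
  exact X_sub_X_ne_zero (by simpa [eq_comm] using hl)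

/-- The scalar product as a positive definite inner product. -/
abbrev scalarProductCore (N β : ℕ) : InnerProductSpace.Core ℂ (SuperPoly N) where
  inner := scalarProduct β
  conj_inner_symm := scalarProduct_conj β
  re_inner_nonneg := scalarProduct_self_nonneg β
  add_left := scalarProduct_add_left β
  smul_left := scalarProduct_smul_left β
  definite := scalarProduct_definite β

theorem degree_finite {N : ℕ} (d : ℕ) : {Ω : Superpartition N | Ω.degree = d}.Finite := by
  have hinj : Function.Injective fun Ω : Superpartition N => (Ω.m, Ω.part) := by
    intro Ω Λ h
    exact Superpartition.ext (Prod.mk.inj h).1 (Prod.mk.inj h).2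
  refine Set.Finite.of_finite_image (f := fun Ω : Superpartition N => (Ω.m, Ω.part)) ?_
    hinj.injOn
  refine ((Set.finite_Iic N).prod (Set.finite_Iic (fun _ : Fin N => d))).subset ?_
  rintro _ ⟨Ω, hΩ, rfl⟩
  refine ⟨Ω.m_le, fun i => ?_⟩
  rw [← (hΩ : Ω.degree = d)]
  exact Finset.single_le_sum (f := Ω.part) (fun _ _ => Nat.zero_le _) (Finset.mem_univ i)

theorem dominanceLT_finite {N : ℕ} (Λ : Superpartition N) :
    {Ω : Superpartition N | dominanceLT Ω Λ}.Finite :=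
  (degree_finite Λ.degree).subset fun _ h => h.1.2.1

theorem existsUnique_orthogonalisation {N : ℕ} (β : ℕ) (Λ : Superpartition N) :
    ∃! F : SuperPoly N,
      F - superMonomial Λ ∈ Submodule.span ℂ (superMonomial '' {Ω | dominanceLT Ω Λ}) ∧
      ∀ Ω, dominanceLT Ω Λ → scalarProduct β (superMonomial Ω) F = 0 := by
  let c : InnerProductSpace.Core ℂ (SuperPoly N) := scalarProductCore N β
  let : NormedAddCommGroup (SuperPoly N) := c.toNormedAddCommGroup
  let : InnerProductSpace ℂ (SuperPoly N) := InnerProductSpace.ofCore c.toCore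
  have hi : ∀ A B : SuperPoly N, inner ℂ A B = scalarProduct β A B := fun _ _ => rfl
  set V : Submodule ℂ (SuperPoly N) :=
    Submodule.span ℂ (superMonomial '' {Ω | dominanceLT Ω Λ}) with hV
  have : FiniteDimensional ℂ V :=
    FiniteDimensional.span_of_finite ℂ ((dominanceLT_finite Λ).image _)
  have key : ∀ F : SuperPoly N,
      (∀ Ω, dominanceLT Ω Λ → scalarProduct β (superMonomial Ω) F = 0) → F ∈ Vᗮ := by
    intro F hF
    rw [Submodule.mem_orthogonal]
    intro u hu
    induction hu using Submodule.span_induction with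
    | mem x hx => obtain ⟨Ω, hΩ, rfl⟩ := hx; exact hF Ω hΩ
    | zero => exact inner_zero_left _
    | add x y _ _ hx hy => rw [inner_add_left, hx, hy, add_zero]
    | smul a x _ hx => rw [inner_smul_left, hx, mul_zero]
  refine ⟨superMonomial Λ - V.starProjection (superMonomial Λ), ⟨?_, ?_⟩, ?_⟩
  · rw [sub_sub_cancel_left]
    exact V.neg_mem (Submodule.starProjection_apply_mem V _)
  · intro Ω hΩ
    exact (Submodule.mem_orthogonal V _).mp (Submodule.sub_starProjection_mem_orthogonal _) _
      (Submodule.subset_span ⟨Ω, hΩ, rfl⟩)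
  · rintro F ⟨h1, h2⟩
    have h3 : V.starProjection (superMonomial Λ) = superMonomial Λ - F :=
      Submodule.eq_starProjection_of_mem_orthogonal
        (by simpa using V.neg_mem h1) (by simpa using key F h2)
    rw [h3, sub_sub_cancel]

/-! ### Jack superpolynomials -/

/-- The Jack superpolynomial `J_Λ(x, θ; 1/β)`, obtained from `m_Λ` by orthogonalisation: the
unique superpolynomial `J_Λ = m_Λ + ∑_{Ω < Λ} t_{ΛΩ} m_Ω` that is orthogonal with respect to
`⟨·, ·⟩_β` to all `m_Ω` with `Ω < Λ`. -/
def jack {N : ℕ} (β : ℕ) (Λ : Superpartition N) : SuperPoly N :=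
  (existsUnique_orthogonalisation β Λ).choose

theorem jack_sub_mem {N : ℕ} (β : ℕ) (Λ : Superpartition N) :
    jack β Λ - superMonomial Λ ∈
      Submodule.span ℂ (superMonomial '' {Ω : Superpartition N | dominanceLT Ω Λ}) :=
  (existsUnique_orthogonalisation β Λ).choose_spec.1.1

theorem scalarProduct_superMonomial_jack {N : ℕ} (β : ℕ) {Ω Λ : Superpartition N}
    (h : dominanceLT Ω Λ) : scalarProduct β (superMonomial Ω) (jack β Λ) = 0 :=
  (existsUnique_orthogonalisation β Λ).choose_spec.1.2 Ω h

theorem PartialSumsLE.antisymm {a b : List ℕ} (hl : a.length = b.length)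
    (h1 : PartialSumsLE a b) (h2 : PartialSumsLE b a) : a = b := by
  refine List.ext_getElem hl fun i hi hi' => ?_
  have e : ∀ k, (a.take k).sum = (b.take k).sum := fun k => le_antisymm (h1 k) (h2 k)
  have e1 := e (i + 1)
  rw [List.sum_take_succ a i hi, List.sum_take_succ b i hi', e i] at e1
  exact Nat.add_left_cancel e1

theorem PartialSumsLE.trans {a b c : List ℕ} (h1 : PartialSumsLE a b) (h2 : PartialSumsLE b c) :
    PartialSumsLE a c := fun k => (h1 k).trans (h2 k)

theorem Superpartition.length_star {N : ℕ} (Λ : Superpartition N) : Λ.star.length = N := by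
  simp [Superpartition.star, Superpartition.comp]

theorem Superpartition.length_comp {N : ℕ} (Λ : Superpartition N) : Λ.comp.length = N := by
  simp [Superpartition.comp]

theorem dominanceLE.antisymm {N : ℕ} {Ω Λ : Superpartition N} (h1 : dominanceLE Ω Λ)
    (h2 : dominanceLE Λ Ω) : Ω = Λ := by
  obtain ⟨hm, -, h1⟩ := h1
  obtain ⟨-, -, h2⟩ := h2
  have hs : Ω.star = Λ.star := by
    by_contra hne
    have h1' := (h1.resolve_right fun h => hne h.1).2
    have h2' := (h2.resolve_right fun h => hne h.1.symm).2
    exact hne (h1'.antisymm (by rw [Ω.length_star, Λ.length_star]) h2')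
  have h1' := (h1.resolve_left fun h => h.1 hs).2
  have h2' := (h2.resolve_left fun h => h.1 hs.symm).2
  have hc := h1'.antisymm (by rw [Ω.length_comp, Λ.length_comp]) h2'
  exact Superpartition.ext hm (List.ofFn_injective hc)

theorem dominanceLE.trans {N : ℕ} {Γ Ω Λ : Superpartition N} (h1 : dominanceLE Γ Ω)
    (h2 : dominanceLE Ω Λ) : dominanceLE Γ Λ := by
  obtain ⟨hm1, hd1, h1⟩ := h1
  obtain ⟨hm2, hd2, h2⟩ := h2
  refine ⟨hm1.trans hm2, hd1.trans hd2, ?_⟩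
  rcases h1 with ⟨n1, s1⟩ | ⟨e1, c1⟩ <;> rcases h2 with ⟨n2, s2⟩ | ⟨e2, c2⟩
  · refine Or.inl ⟨fun e => ?_, s1.trans s2⟩
    rw [← e] at s2
    exact n1 (s1.antisymm (by rw [Γ.length_star, Ω.length_star]) s2)
  · exact Or.inl (e2 ▸ ⟨n1, s1⟩)
  · exact Or.inl (e1 ▸ ⟨n2, s2⟩)
  · exact Or.inr ⟨e1.trans e2, c1.trans c2⟩

theorem dominanceLT.trans {N : ℕ} {Γ Ω Λ : Superpartition N} (h1 : dominanceLT Γ Ω)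
    (h2 : dominanceLT Ω Λ) : dominanceLT Γ Λ := by
  refine ⟨h1.1.trans h2.1, ?_⟩
  rintro rfl
  exact h1.2 (h1.1.antisymm h2.1)

/-- The defining properties of the Jack superpolynomials: a family in `P^{S_N}` that is orthogonal
with respect to `⟨·, ·⟩_β` and satisfies `J_Λ = m_Λ + ∑_{Ω < Λ} t_{ΛΩ} m_Ω`. -/
def IsJackFamily {N : ℕ} (β : ℕ) (J : Superpartition N → SuperPoly N) : Prop :=
  (∀ Λ, J Λ ∈ symmetricSubspace N) ∧
  (∀ Λ Ω, Λ ≠ Ω → scalarProduct β (J Λ) (J Ω) = 0) ∧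
  ∀ Λ, J Λ - superMonomial Λ ∈
    Submodule.span ℂ (superMonomial '' {Ω : Superpartition N | dominanceLT Ω Λ})

/-- A family with the defining properties of the Jack superpolynomials consists of the
superpolynomials `jack β Λ`. -/
theorem IsJackFamily.eq_jack {N : ℕ} {β : ℕ} {J : Superpartition N → SuperPoly N}
    (hJ : IsJackFamily β J) : J = jack β := by
  have hspan : ∀ n : ℕ, ∀ Ω : Superpartition N, {Γ | dominanceLT Γ Ω}.ncard = n →
      superMonomial Ω ∈ Submodule.span ℂ (J '' {Γ | dominanceLE Γ Ω}) := by
    intro n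
    induction n using Nat.strong_induction_on with
    | _ n ih =>
      rintro Ω rfl
      have hrefl : dominanceLE Ω Ω := ⟨rfl, rfl, Or.inr ⟨rfl, fun _ => le_rfl⟩⟩
      have h1 : J Ω ∈ Submodule.span ℂ (J '' {Γ | dominanceLE Γ Ω}) :=
        Submodule.subset_span ⟨Ω, hrefl, rfl⟩
      have h2 : Submodule.span ℂ (superMonomial '' {Γ : Superpartition N | dominanceLT Γ Ω}) ≤
          Submodule.span ℂ (J '' {Γ | dominanceLE Γ Ω}) := by
        rw [Submodule.span_le]
        rintro _ ⟨Γ, hΓ, rfl⟩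
        refine Submodule.span_mono ?_ (ih _ (Set.ncard_lt_ncard ?_ (dominanceLT_finite Ω)) Γ rfl)
        · exact Set.image_mono fun Θ hΘ => dominanceLE.trans hΘ hΓ.1
        · exact ⟨fun Θ hΘ => dominanceLT.trans hΘ hΓ, fun hs => (hs hΓ).2 rfl⟩
      have h3 := Submodule.sub_mem _ h1 (h2 (hJ.2.2 Ω))
      rwa [sub_sub_cancel] at h3
  funext Λ
  refine (existsUnique_orthogonalisation β Λ).unique ⟨hJ.2.2 Λ, fun Ω hΩ => ?_⟩
    (existsUnique_orthogonalisation β Λ).choose_spec.1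
  have h := hspan _ Ω rfl
  have hz : scalarProduct β 0 (J Λ) = 0 := by
    simpa using scalarProduct_smul_left β (0 : SuperPoly N) (J Λ) 0
  generalize superMonomial Ω = v at h ⊢
  induction h using Submodule.span_induction with
  | mem x hx =>
    obtain ⟨Γ, hΓ, rfl⟩ := hx
    refine hJ.2.1 Γ Λ ?_
    rintro rfl
    exact hΩ.2 (hΩ.1.antisymm hΓ)
  | zero => exact hz
  | add x y _ _ hx hy => rw [scalarProduct_add_left, hx, hy, add_zero]
  | smul a x _ hx => rw [scalarProduct_smul_left, hx, mul_zero]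

/-! ### Generalized Hermite superpolynomials -/

/-- The generalized Hermite superpolynomial `J_Λ^ω = e^{-Δ/(4ω)} J_Λ`. -/
def hermite {N : ℕ} (β : ℕ) (ω : ℝ) (Λ : Superpartition N) : SuperPoly N :=
  expLaplacian β ω (jack β Λ)

/-- The family `F` is a basis of `P^{S_N}` with `H_1^ω F_Λ = |Λ| F_Λ` and
`F_Λ = J_Λ + ∑_{Ω <_u Λ} w_{ΛΩ} J_Ω` for all superpartitions `Λ`. -/
structure IsTriangularEigenbasis {N : ℕ} (β : ℕ) (ω : ℝ)
    (F : Superpartition N → SuperPoly N) : Prop where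
  linearIndependent : LinearIndependent ℂ F
  span_eq : Submodule.span ℂ (Set.range F) = symmetricSubspace N
  eigen : ∀ Λ, hamiltonian N β ω (F Λ) = (Λ.degree : ℂ) • F Λ
  triangular : ∀ Λ, ∃ w : Superpartition N →₀ ℂ,
    (∀ Ω ∈ w.support, uLT Ω Λ) ∧ F Λ = jack β Λ + w.sum fun Ω c => c • jack β Ω

end SuperCMS

end

/-! Let `E` be the Euler operator. In `∑_j x_j D_j` the divided differences of the pairs `(j,k)` and
`(k,j)` combine to `1 - K_{jk}`, so the exchange terms and constants of the Hamiltonian cancel,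
leaving `E - Δ/(2ω)` (`sum_omegaDunkl`). Each `D_j` lowers the degree by one, hence `[E, Δ] = -2Δ`
and `(E - Δ/(2ω)) e^{-Δ/(4ω)} = e^{-Δ/(4ω)} E`. Since `J_Λ` is homogeneous of degree `|Λ|`, its
image `J_Λ^ω` is an eigenvector with eigenvalue `|Λ|` (`hamiltonian_expLaplacian`).

Since `Δ` commutes with `S_N`, `Δ^n J_Λ` is symmetric of degree `|Λ| - 2n`, hence a combination of
the `J_Ω` of that degree: this is the triangularity (`hermite_sub_jack_mem`). It needs the Jack
superpolynomials to be a basis of `P^{S_N}`. They are unitriangular over the `m_Λ`, which form a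
basis because each orbit of monomials `θ_I x^s` has at most one superpartition representative, and a
symmetric superpolynomial is determined by its coefficients at these (`exists_normalCoeff_ne_zero`).
Unitriangularity then carries the basis property on to the `J_Λ^ω`.

For uniqueness, the difference of two candidates at `Λ` has eigenvalue `|Λ|`, yet lies in the span
of the `J_Ω^ω` with `Ω <_u Λ`, whose eigenvalues are smaller; so it vanishes. -/

namespace SuperCMS

/-! ### The Euler operator -/

/-- The Euler operator `∑_j x_j ∂_j`. -/
noncomputable def euler (N : ℕ) : Module.End ℂ (MvPolynomial (Fin N) ℂ) :=
  ∑ j, mulX j * (pderiv j).toLinearMap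

theorem euler_apply {N : ℕ} (f : MvPolynomial (Fin N) ℂ) :
    euler N f = ∑ j, X j * pderiv j f := by
  simp [euler, mulX, LinearMap.sum_apply]

theorem euler_monomial {N : ℕ} (s : Fin N →₀ ℕ) (a : ℂ) :
    euler N (monomial s a) = ((∑ i, s i : ℕ) : ℂ) • monomial s a := by
  rw [euler_apply]
  simp only [X_mul_pderiv_monomial]
  rw [← Finset.sum_smul, Nat.cast_smul_eq_nsmul]

theorem coeff_euler {N : ℕ} (s : Fin N →₀ ℕ) (f : MvPolynomial (Fin N) ℂ) :
    coeff s (euler N f) = ((∑ i, s i : ℕ) : ℂ) * coeff s f := by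
  induction f using MvPolynomial.induction_on' with
  | monomial t a =>
    rw [euler_monomial, coeff_smul, coeff_monomial, smul_eq_mul]
    split_ifs with h
    · rw [h]
    · simp
  | add p q hp hq => rw [map_add, coeff_add, coeff_add, hp, hq, mul_add]

theorem euler_mul {N : ℕ} (f g : MvPolynomial (Fin N) ℂ) :
    euler N (f * g) = f * euler N g + euler N f * g := by
  simp only [euler_apply, Derivation.leibniz, smul_eq_mul, Finset.mul_sum, Finset.sum_mul]
  rw [← Finset.sum_add_distrib]
  exact Finset.sum_congr rfl fun j _ => by ring

theorem euler_X {N : ℕ} (j : Fin N) : euler N (X j) = X j := by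
  rw [euler_apply, Finset.sum_eq_single j]
  · simp
  · intro k _ hk
    rw [pderiv_X_of_ne hk.symm, mul_zero]
  · simp

theorem euler_rename {N : ℕ} (σ : Equiv.Perm (Fin N)) (f : MvPolynomial (Fin N) ℂ) :
    euler N (rename σ f) = rename σ (euler N f) := by
  rw [euler_apply, euler_apply, map_sum, ← Equiv.sum_comp σ]
  refine Finset.sum_congr rfl fun j _ => ?_
  rw [pderiv_rename σ.injective, map_mul, rename_X]

theorem euler_pderiv {N : ℕ} (j : Fin N) (f : MvPolynomial (Fin N) ℂ) :
    euler N (pderiv j f) = pderiv j (euler N f) - pderiv j f := by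
  ext s
  rw [coeff_sub, coeff_euler, coeff_pderiv, coeff_pderiv, coeff_euler]
  have : ∑ i, (s + Finsupp.single j 1 : Fin N →₀ ℕ) i = ∑ i, s i + 1 := by
    simp [Finset.sum_add_distrib, Finsupp.single_apply]
  rw [this]
  push_cast
  ring

/-- Apply the derivation `E` to `(x_j - x_k) · dividedDifference j k f = f - K_{jk} f`, using that
`E` fixes `x_j - x_k` and commutes with `K_{jk}`. -/
theorem euler_dividedDifference {N : ℕ} {j k : Fin N} (h : j ≠ k)
    (f : MvPolynomial (Fin N) ℂ) :
    euler N (dividedDifference j k f) =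
      dividedDifference j k (euler N f) - dividedDifference j k f := by
  apply mul_left_cancel₀ (X_sub_X_ne_zero h)
  have h1 := congrArg (euler N) (mul_dividedDifference h f)
  rw [euler_mul, map_sub, map_sub, euler_X, euler_X, euler_rename] at h1
  rw [mul_sub, mul_dividedDifference h (euler N f), ← h1]
  ring

theorem dunkl_apply {N : ℕ} (β : ℕ) (j : Fin N) (f : MvPolynomial (Fin N) ℂ) :
    dunkl β j f = pderiv j f + (β : ℂ) • ∑ k ∈ {j}ᶜ, dividedDifference j k f := by
  simp [dunkl, dividedDifferenceₗ, LinearMap.sum_apply]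

theorem euler_dunkl {N : ℕ} (β : ℕ) (j : Fin N) (f : MvPolynomial (Fin N) ℂ) :
    euler N (dunkl β j f) = dunkl β j (euler N f) - dunkl β j f := by
  simp only [dunkl_apply, map_add, map_smul, map_sum, euler_pderiv]
  rw [Finset.sum_congr rfl fun k hk =>
    euler_dividedDifference (j := j) (k := k) (by simpa [eq_comm] using hk) f,
    Finset.sum_sub_distrib, smul_sub]
  ring

/-! ### The Hamiltonian in terms of the Euler operator and the Laplacian -/

theorem dividedDifference_swap {N : ℕ} {j k : Fin N} (h : j ≠ k) (f : MvPolynomial (Fin N) ℂ) :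
    dividedDifference k j f = -dividedDifference j k f := by
  apply mul_left_cancel₀ (X_sub_X_ne_zero h)
  have h1 := mul_dividedDifference h f
  have h2 := mul_dividedDifference h.symm f
  rw [Equiv.swap_comm] at h2
  linear_combination (-1 : MvPolynomial (Fin N) ℂ) * h2 + h1

theorem sum_sum_Ioi_one (N : ℕ) :
    ∑ j : Fin N, ∑ _k ∈ Finset.Ioi j, (1 : ℂ) = (N : ℂ) * ((N : ℂ) - 1) / 2 := by
  have h := Finset.sum_sum_Ioi_add_eq_sum_sum_off_diag (fun _ _ : Fin N => (1 : ℂ))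
  simp only [Finset.sum_const, Finset.card_compl, Fintype.card_fin, Finset.card_singleton,
    Finset.card_univ, nsmul_eq_mul, mul_one] at h ⊢
  -- The complement of a point has `N - 1` elements with truncated subtraction, so `N = 0` is
  -- separate.
  rcases N with _ | n
  · simp
  · push_cast [Nat.add_sub_cancel] at h ⊢
    rw [eq_div_iff two_ne_zero, Finset.sum_mul, Finset.sum_congr rfl fun j _ =>
      (show ((Finset.Ioi j).card : ℂ) * 2 = ((Finset.Ioi j).card : ℂ) * (1 + 1) by ring), h]
    ring

/-- Grouping `(j,k)` with `(k,j)`, whose divided differences are opposite, gives `(x_j - x_k)` times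
one divided difference, that is `1 - K_{jk}` for each pair `j < k`. -/
theorem sum_X_mul_dunkl {N : ℕ} (β : ℕ) (f : MvPolynomial (Fin N) ℂ) :
    ∑ j, X j * dunkl β j f = euler N f +
      (β : ℂ) • (((N : ℂ) * ((N : ℂ) - 1) / 2) • f -
        ∑ j, ∑ k ∈ Finset.Ioi j, rename (Equiv.swap j k) f) := by
  simp only [dunkl_apply, mul_add, Finset.sum_add_distrib, ← euler_apply, mul_smul_comm,
    ← Finset.smul_sum, Finset.mul_sum]
  congr 2
  rw [← Finset.sum_sum_Ioi_add_eq_sum_sum_off_diag (fun k j : Fin N =>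
    X j * dividedDifference j k f), ← sum_sum_Ioi_one, Finset.sum_smul, ← Finset.sum_sub_distrib]
  refine Finset.sum_congr rfl fun j _ => ?_
  rw [Finset.sum_smul, ← Finset.sum_sub_distrib]
  refine Finset.sum_congr rfl fun k hk => ?_
  have hne : j ≠ k := (Finset.mem_Ioi.mp hk).ne
  rw [dividedDifference_swap hne, one_smul, ← mul_dividedDifference hne]
  ring

theorem sum_omegaDunkl {N : ℕ} (β : ℕ) {ω : ℝ} (hω : ω ≠ 0) :
    ∑ j, omegaDunkl (N := N) β ω j + ((β : ℂ) * (N : ℂ) * ((N : ℂ) - 1) / 2) • 1 =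
      euler N - (2 * (ω : ℂ))⁻¹ • ∑ j, dunkl β j ^ 2 := by
  have hω' : (2 * (ω : ℂ)) ≠ 0 := by simpa using hω
  refine LinearMap.ext fun f => ?_
  have h : ∀ j, omegaDunkl (N := N) β ω j f = X j * dunkl β j f -
      (2 * (ω : ℂ))⁻¹ • (dunkl β j ^ 2) f +
      (β : ℂ) • ∑ k ∈ Finset.Ioi j, rename (Equiv.swap j k) f -
      ((β : ℂ) * ((N : ℂ) - 1)) • f := by
    intro j
    simp only [omegaDunkl, dunklAdjoint, exchange, mulX, LinearMap.sub_apply, LinearMap.add_apply,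
      LinearMap.smul_apply, Module.End.mul_apply, LinearMap.sum_apply, Module.End.one_apply,
      LinearMap.mulLeft_apply, AlgHom.toLinearMap_apply, smul_sub, smul_smul,
      inv_mul_cancel₀ hω', one_smul, pow_two]
  simp only [LinearMap.add_apply, LinearMap.sub_apply, LinearMap.sum_apply, LinearMap.smul_apply,
    Module.End.one_apply, h, Finset.sum_add_distrib, Finset.sum_sub_distrib, sum_X_mul_dunkl,
    ← Finset.smul_sum, Finset.sum_const, Finset.card_univ, Fintype.card_fin]
  simp only [← Nat.cast_smul_eq_nsmul ℂ, smul_smul, smul_sub]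
  module

theorem onSuper_apply {N : ℕ} (T : Module.End ℂ (MvPolynomial (Fin N) ℂ)) (F : SuperPoly N)
    (I : Finset (Fin N)) : onSuper T F I = T (F I) := rfl

theorem hamiltonian_eq (N β : ℕ) {ω : ℝ} (hω : ω ≠ 0) (F : SuperPoly N) :
    hamiltonian N β ω F = onSuper (euler N) F - (2 * (ω : ℂ))⁻¹ • laplacian N β F := by
  funext I
  exact DFunLike.congr_fun (sum_omegaDunkl β hω) (F I)

theorem euler_laplacian {N : ℕ} (β : ℕ) (F : SuperPoly N) :
    onSuper (euler N) (laplacian N β F) =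
      laplacian N β (onSuper (euler N) F) - (2 : ℂ) • laplacian N β F := by
  funext I
  simp only [laplacian, Pi.sub_apply, Pi.smul_apply, onSuper_apply, LinearMap.sum_apply, map_sum,
    pow_two, Module.End.mul_apply, euler_dunkl, map_sub, Finset.sum_sub_distrib]
  module

/-- Homogeneity is expressed as an eigenvalue equation for `E` with a complex eigenvalue, so that `c
- 2n` makes sense for all `n`; once it is not a natural number, no monomial can occur. -/
theorem euler_laplacian_pow {N : ℕ} (β : ℕ) {F : SuperPoly N} {c : ℂ}
    (hF : onSuper (euler N) F = c • F) (n : ℕ) :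
    onSuper (euler N) ((laplacian N β ^ n) F) = (c - 2 * n) • (laplacian N β ^ n) F := by
  induction n with
  | zero => simpa using hF
  | succ n ih =>
    rw [pow_succ', Module.End.mul_apply, euler_laplacian, ih, map_smul]
    push_cast
    module

theorem coeff_eq_zero_of_euler {N : ℕ} {F : SuperPoly N} {c : ℂ}
    (hF : onSuper (euler N) F = c • F) (I : Finset (Fin N)) (s : Fin N →₀ ℕ)
    (hs : ((∑ i, s i : ℕ) : ℂ) ≠ c) : coeff s (F I) = 0 := by
  have h := congrArg (coeff s) (congrFun hF I)
  rw [onSuper_apply, coeff_euler, Pi.smul_apply, coeff_smul, smul_eq_mul] at h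
  exact (mul_eq_mul_right_iff.mp h).resolve_left hs

theorem laplacian_pow_eq_zero {N : ℕ} (β : ℕ) {F : SuperPoly N} {d : ℕ}
    (hF : onSuper (euler N) F = (d : ℂ) • F) {n : ℕ} (hn : d < 2 * n) :
    (laplacian N β ^ n) F = 0 := by
  funext I
  ext s
  refine coeff_eq_zero_of_euler (euler_laplacian_pow β hF n) I s fun h => ?_
  have h' : (∑ i, s i) + 2 * n = d := by
    have := eq_sub_iff_add_eq.mp h
    exact_mod_cast this
  omega

theorem expLaplacian_eq_sum {N : ℕ} (β : ℕ) (ω : ℝ) {F : SuperPoly N} {d : ℕ}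
    (hF : onSuper (euler N) F = (d : ℂ) • F) :
    expLaplacian β ω F = ∑ n ∈ Finset.range (d + 1),
      ((n.factorial : ℂ)⁻¹ * (-1 / (4 * (ω : ℂ))) ^ n) • (laplacian N β ^ n) F := by
  refine finsum_eq_sum_of_support_subset _ fun n hn => ?_
  rw [Finset.coe_range, Set.mem_Iio]
  by_contra h
  exact hn (by simp only [laplacian_pow_eq_zero β hF (show d < 2 * n by omega), smul_zero])

theorem hamiltonian_expLaplacian {N : ℕ} (β : ℕ) {ω : ℝ} (hω : ω ≠ 0) {F : SuperPoly N} {d : ℕ}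
    (hF : onSuper (euler N) F = (d : ℂ) • F) :
    hamiltonian N β ω (expLaplacian β ω F) = (d : ℂ) • expLaplacian β ω F := by
  have hω' : (ω : ℂ) ≠ 0 := by exact_mod_cast hω
  rw [expLaplacian_eq_sum β ω hF, hamiltonian_eq N β hω]
  -- With `t_n` the `n`-th term of the exponential and `a n = 2n t_n`, one has `E t_n = d t_n - a n`
  -- and `Δ t_n / (2ω) = -a (n + 1)`. The sum therefore telescopes, and both end terms `a 0` and `a
  -- (d + 1)` vanish.
  set a : ℕ → SuperPoly N := fun n => (2 * n : ℂ) •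
    ((n.factorial : ℂ)⁻¹ * (-1 / (4 * (ω : ℂ))) ^ n) • (laplacian N β ^ n) F with ha
  have ha0 : a 0 = 0 := by simp [ha]
  have hlast : a (d + 1) = 0 := by
    simp only [ha, laplacian_pow_eq_zero β hF (show d < 2 * (d + 1) by omega), smul_zero]
  have hE : ∀ n : ℕ, onSuper (euler N)
      (((n.factorial : ℂ)⁻¹ * (-1 / (4 * (ω : ℂ))) ^ n) • (laplacian N β ^ n) F) =
      (d : ℂ) • (((n.factorial : ℂ)⁻¹ * (-1 / (4 * (ω : ℂ))) ^ n) • (laplacian N β ^ n) F) -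
        a n := by
    intro n
    rw [map_smul, euler_laplacian_pow β hF n]
    simp only [ha]
    module
  have hL : ∀ n : ℕ, (2 * (ω : ℂ))⁻¹ • laplacian N β
      (((n.factorial : ℂ)⁻¹ * (-1 / (4 * (ω : ℂ))) ^ n) • (laplacian N β ^ n) F) =
      -a (n + 1) := by
    intro n
    rw [map_smul, ← Module.End.mul_apply, ← pow_succ']
    simp only [ha, smul_smul]
    rw [← neg_smul]
    congr 1
    have : ((n : ℂ) + 1) ≠ 0 := by exact_mod_cast Nat.succ_ne_zero n
    have := Nat.cast_ne_zero (R := ℂ).mpr n.factorial_ne_zero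
    rw [Nat.factorial_succ, pow_succ]
    push_cast
    field_simp
    ring
  rw [map_sum, map_sum, Finset.smul_sum, Finset.sum_congr rfl fun n _ => hE n,
    Finset.sum_congr rfl fun n _ => hL n, Finset.sum_sub_distrib, Finset.smul_sum,
    Finset.sum_neg_distrib, sub_neg_eq_add]
  have h1 := Finset.sum_range_succ a (d + 1)
  rw [Finset.sum_range_succ', ha0, hlast, add_zero, add_zero] at h1
  rw [h1]
  abel

/-! ### The action of the symmetric group -/

/-- Writing the factor with an equivalence makes it invariant under exchanging the two members of a
pair of distinct indices, so pairs can be reindexed by a permutation without tracking their order.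
-/
theorem neg_one_pow_inversions {N : ℕ} (σ : Equiv.Perm (Fin N)) (I : Finset (Fin N)) :
    (-1 : ℂ) ^ inversions σ I =
      ∏ p ∈ (I ×ˢ I).filter (fun p => p.1 < p.2),
        if (p.1 < p.2 ↔ σ p.1 < σ p.2) then (1 : ℂ) else -1 := by
  rw [inversions, ← Finset.filter_filter, ← Finset.prod_const, Finset.prod_filter]
  refine Finset.prod_congr rfl fun p hp => ?_
  have h := (Finset.mem_filter.mp hp).2
  have hne : σ p.1 ≠ σ p.2 := fun e => h.ne (σ.injective e)
  rcases hne.lt_or_gt with h' | h'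
  · simp [h, h', h'.not_gt]
  · simp [h, h', h'.not_gt]

theorem neg_one_pow_inversions_mul {N : ℕ} (σ τ : Equiv.Perm (Fin N)) (I : Finset (Fin N)) :
    (-1 : ℂ) ^ inversions (σ * τ) I =
      (-1) ^ inversions σ (I.map τ.toEmbedding) * (-1) ^ inversions τ I := by
  simp only [neg_one_pow_inversions]
  have h : ∏ p ∈ ((I.map τ.toEmbedding) ×ˢ (I.map τ.toEmbedding)).filter (fun p => p.1 < p.2),
        (if (p.1 < p.2 ↔ σ p.1 < σ p.2) then (1 : ℂ) else -1) =
      ∏ p ∈ (I ×ˢ I).filter (fun p => p.1 < p.2),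
        if (τ p.1 < τ p.2 ↔ σ (τ p.1) < σ (τ p.2)) then (1 : ℂ) else -1 := by
    symm
    -- An increasing pair in `I` may become decreasing under `τ`; it is put back in order.
    refine Finset.prod_bij' (fun p _ => if τ p.1 < τ p.2 then (τ p.1, τ p.2) else (τ p.2, τ p.1))
      (fun p _ => if τ.symm p.1 < τ.symm p.2 then (τ.symm p.1, τ.symm p.2)
        else (τ.symm p.2, τ.symm p.1)) ?_ ?_ ?_ ?_ ?_
    · rintro ⟨p, q⟩ h
      simp only [Finset.mem_filter, Finset.mem_product] at h
      have hne : τ p ≠ τ q := fun e => h.2.ne (τ.injective e)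
      rcases hne.lt_or_gt with h' | h'
      · simp [h', h.1]
      · simp [h', h'.not_gt, h.1]
    · rintro ⟨p, q⟩ h
      simp only [Finset.mem_filter, Finset.mem_product, Finset.mem_map_equiv] at h
      have hne : τ.symm p ≠ τ.symm q := fun e => h.2.ne (τ.symm.injective e)
      rcases hne.lt_or_gt with h' | h'
      · simp [h', h.1]
      · simp [h', h'.not_gt, h.1]
    · rintro ⟨p, q⟩ h
      simp only [Finset.mem_filter, Finset.mem_product] at h
      have hne : τ p ≠ τ q := fun e => h.2.ne (τ.injective e)
      rcases hne.lt_or_gt with h' | h'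
      · simp [h', h.2]
      · simp [h'.not_gt, h.2.not_gt]
    · rintro ⟨p, q⟩ h
      simp only [Finset.mem_filter, Finset.mem_product, Finset.mem_map_equiv] at h
      have hne : τ.symm p ≠ τ.symm q := fun e => h.2.ne (τ.symm.injective e)
      rcases hne.lt_or_gt with h' | h'
      · simp [h', h.2]
      · simp [h'.not_gt, h.2.not_gt]
    · rintro ⟨p, q⟩ h
      simp only [Finset.mem_filter, Finset.mem_product] at h
      have hne : τ p ≠ τ q := fun e => h.2.ne (τ.injective e)
      have hne' : σ (τ p) ≠ σ (τ q) := fun e => hne (σ.injective e)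
      rcases hne.lt_or_gt with h' | h' <;> rcases hne'.lt_or_gt with h'' | h'' <;>
        simp [h', h'.not_gt, h'', h''.not_gt]
  rw [h, ← Finset.prod_mul_distrib]
  refine Finset.prod_congr rfl fun p _ => ?_
  simp only [Equiv.Perm.mul_apply]
  by_cases h1 : p.1 < p.2 <;> by_cases h2 : τ p.1 < τ p.2 <;>
    by_cases h3 : σ (τ p.1) < σ (τ p.2) <;> simp [h1, h2, h3]

theorem permAction_apply_map {N : ℕ} (σ : Equiv.Perm (Fin N)) (F : SuperPoly N)
    (I : Finset (Fin N)) :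
    permAction σ F (I.map σ.toEmbedding) = (-1 : ℂ) ^ inversions σ I • rename σ (F I) := by
  have h : (I.map σ.toEmbedding).map σ.symm.toEmbedding = I := by
    ext i; simp
  show (-1 : ℂ) ^ inversions σ ((I.map σ.toEmbedding).map σ.symm.toEmbedding) •
    rename σ (F ((I.map σ.toEmbedding).map σ.symm.toEmbedding)) = _
  rw [h]

theorem exists_eq_map_perm {N : ℕ} (σ : Equiv.Perm (Fin N)) (J : Finset (Fin N)) :
    ∃ I : Finset (Fin N), I.map σ.toEmbedding = J :=
  ⟨J.map σ.symm.toEmbedding, by ext i; simp⟩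

theorem permAction_permAction {N : ℕ} (σ τ : Equiv.Perm (Fin N)) (F : SuperPoly N) :
    permAction σ (permAction τ F) = permAction (σ * τ) F := by
  funext J
  obtain ⟨J', rfl⟩ := exists_eq_map_perm σ J
  obtain ⟨I, rfl⟩ := exists_eq_map_perm τ J'
  have h : (I.map τ.toEmbedding).map σ.toEmbedding = I.map (σ * τ).toEmbedding := by
    rw [Finset.map_map]; rfl
  rw [permAction_apply_map, permAction_apply_map, h, permAction_apply_map,
    neg_one_pow_inversions_mul, map_smul, smul_smul, rename_rename]
  rfl

theorem permAction_one {N : ℕ} (F : SuperPoly N) : permAction 1 F = F := by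
  funext J
  have h : J.map (1 : Equiv.Perm (Fin N)).toEmbedding = J := by
    ext i; rw [Finset.mem_map_equiv]; rfl
  have h0 : inversions (1 : Equiv.Perm (Fin N)) J = 0 := by
    rw [inversions, Finset.card_eq_zero, Finset.filter_eq_empty_iff]
    exact fun p _ hp => hp.1.not_gt hp.2
  have h1 := permAction_apply_map 1 F J
  rw [h, h0, pow_zero, one_smul] at h1
  rw [h1]
  exact rename_id_apply _

theorem permAction_eq_self {N : ℕ} {F : SuperPoly N} (hF : F ∈ symmetricSubspace N)
    (σ : Equiv.Perm (Fin N)) : permAction σ F = F := by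
  induction σ using Equiv.Perm.swap_induction_on with
  | one => exact permAction_one F
  | swap_mul f i j _ ih => rw [← permAction_permAction, ih, hF i j]

theorem coeff_permAction {N : ℕ} (σ : Equiv.Perm (Fin N)) (F : SuperPoly N)
    (I : Finset (Fin N)) (s : Fin N →₀ ℕ) :
    coeff (s.mapDomain σ) (permAction σ F (I.map σ.toEmbedding)) =
      (-1 : ℂ) ^ inversions σ I * coeff s (F I) := by
  rw [permAction_apply_map, coeff_smul, coeff_rename_mapDomain _ σ.injective, smul_eq_mul]

theorem superMonomial_mem {N : ℕ} (Λ : Superpartition N) :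
    superMonomial Λ ∈ symmetricSubspace N := by
  intro i j
  rw [superMonomial, map_smul, map_sum]
  congr 1
  simp only [permAction_permAction]
  exact Equiv.sum_comp (Equiv.mulLeft (Equiv.swap i j)) fun σ => permAction σ (leadingTerm Λ)

theorem rename_dividedDifference {N : ℕ} (σ : Equiv.Perm (Fin N)) {j k : Fin N} (h : j ≠ k)
    (f : MvPolynomial (Fin N) ℂ) :
    rename σ (dividedDifference j k f) = dividedDifference (σ j) (σ k) (rename σ f) := by
  have h' : σ j ≠ σ k := fun e => h (σ.injective e)
  apply mul_left_cancel₀ (X_sub_X_ne_zero h')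
  have h1 := congrArg (rename σ) (mul_dividedDifference h f)
  rw [map_mul, map_sub, map_sub, rename_X, rename_X, rename_rename] at h1
  rw [h1, mul_dividedDifference h', rename_rename]
  congr 3
  funext i
  simp [Equiv.swap_apply_apply]

theorem rename_dunkl {N : ℕ} (β : ℕ) (σ : Equiv.Perm (Fin N)) (j : Fin N)
    (f : MvPolynomial (Fin N) ℂ) :
    rename σ (dunkl β j f) = dunkl β (σ j) (rename σ f) := by
  rw [dunkl_apply, dunkl_apply, map_add, pderiv_rename σ.injective, map_smul, map_sum]
  congr 2
  refine Finset.sum_bij (fun k _ => σ k) ?_ ?_ ?_ ?_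
  · intro k hk; simpa using hk
  · intro a _ b _ hab; exact σ.injective hab
  · intro k hk
    exact ⟨σ.symm k, by simpa [Equiv.symm_apply_eq] using hk, by simp⟩
  · intro k hk
    exact rename_dividedDifference σ (by simpa [eq_comm] using hk) f

/-- Conjugation by `σ` takes `D_j` to `D_{σ j}`, so it only permutes the summands of `Δ`; the sign
of the odd part is a scalar. -/
theorem laplacian_permAction {N : ℕ} (β : ℕ) (σ : Equiv.Perm (Fin N)) (F : SuperPoly N) :
    laplacian N β (permAction σ F) = permAction σ (laplacian N β F) := by
  funext J
  obtain ⟨I, rfl⟩ := exists_eq_map_perm σ J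
  rw [laplacian, onSuper_apply, permAction_apply_map, permAction_apply_map, onSuper_apply, map_smul]
  congr 1
  simp only [LinearMap.sum_apply, map_sum, pow_two, Module.End.mul_apply, rename_dunkl]
  exact (Equiv.sum_comp σ fun j => dunkl β j (dunkl β j (rename σ (F I)))).symm

theorem laplacian_pow_mem {N : ℕ} (β : ℕ) {F : SuperPoly N} (hF : F ∈ symmetricSubspace N)
    (n : ℕ) : (laplacian N β ^ n) F ∈ symmetricSubspace N := by
  induction n with
  | zero => simpa using hF
  | succ n ih =>
    intro i j
    rw [pow_succ', Module.End.mul_apply, ← laplacian_permAction, ih i j]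

/-! ### Normal coefficients -/

/-- The set of indices `{1, …, m}` of the fermionic entries. -/
def Superpartition.fermions {N : ℕ} (Λ : Superpartition N) : Finset (Fin N) :=
  Finset.univ.filter fun i : Fin N => (i : ℕ) < Λ.m

theorem Superpartition.mem_fermions {N : ℕ} {Λ : Superpartition N} {i : Fin N} :
    i ∈ Λ.fermions ↔ (i : ℕ) < Λ.m := by
  simp [Superpartition.fermions]

theorem Superpartition.card_fermions {N : ℕ} (Λ : Superpartition N) :
    Λ.fermions.card = Λ.m := by
  rw [Superpartition.fermions, Fin.card_filter_val_lt, min_eq_right Λ.m_le]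

/-- The exponent vector of a superpartition. -/
noncomputable def Superpartition.exponent {N : ℕ} (Λ : Superpartition N) : Fin N →₀ ℕ :=
  Finsupp.equivFunOnFinite.symm Λ.part

theorem Superpartition.exponent_apply {N : ℕ} (Λ : Superpartition N) (i : Fin N) :
    Λ.exponent i = Λ.part i := rfl

/-- The coefficient of `θ_1 ⋯ θ_m x^Λ`. -/
noncomputable def normalCoeff {N : ℕ} (Λ : Superpartition N) : SuperPoly N →ₗ[ℂ] ℂ :=
  lcoeff ℂ Λ.exponent ∘ₗ LinearMap.proj Λ.fermions

theorem normalCoeff_apply {N : ℕ} (Λ : Superpartition N) (F : SuperPoly N) :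
    normalCoeff Λ F = coeff Λ.exponent (F Λ.fermions) := rfl

/-- The order on the positions of a monomial `θ_I x^s` that is monotone exactly for the leading
terms of superpartitions, up to repetitions in the fermionic part. -/
def sortKey {N : ℕ} (I : Finset (Fin N)) (s : Fin N → ℕ) (i : Fin N) : Bool ×ₗ ℕᵒᵈ :=
  toLex (decide (i ∉ I), OrderDual.toDual (s i))

theorem sortKey_le_iff {N : ℕ} {I : Finset (Fin N)} {s : Fin N → ℕ} {i j : Fin N} :
    sortKey I s i ≤ sortKey I s j ↔ (i ∈ I ∧ j ∉ I) ∨ ((i ∈ I ↔ j ∈ I) ∧ s j ≤ s i) := by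
  rw [sortKey, sortKey, Prod.Lex.toLex_le_toLex]
  by_cases hi : i ∈ I <;> by_cases hj : j ∈ I <;> simp [hi, hj]

theorem Superpartition.monotone_sortKey {N : ℕ} (Λ : Superpartition N) :
    Monotone (sortKey Λ.fermions Λ.part) := by
  intro i j hij
  rw [sortKey_le_iff]
  simp only [Superpartition.mem_fermions]
  rcases hij.eq_or_lt with rfl | hlt
  · simp
  · have hlt' : (i : ℕ) < j := hlt
    by_cases hj : (j : ℕ) < Λ.m
    · exact Or.inr ⟨by omega, (Λ.strict i j hlt hj).le⟩
    · by_cases hi : (i : ℕ) < Λ.m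
      · exact Or.inl ⟨hi, hj⟩
      · exact Or.inr ⟨by omega, Λ.weak i j (by omega) hlt⟩

/-- The keys of a superpartition are sorted, and a tuple has only one sorted rearrangement.
Fermionic entries are distinct, so `σ` must fix every fermionic position and no sign appears. -/
theorem Superpartition.eq_of_perm {N : ℕ} {Ω Λ : Superpartition N} {σ : Equiv.Perm (Fin N)}
    (hI : Λ.fermions.map σ.toEmbedding = Ω.fermions) (hs : Λ.exponent.mapDomain σ = Ω.exponent) :
    Λ = Ω ∧ inversions σ Λ.fermions = 0 := by
  have hm : Λ.m = Ω.m := by rw [← Λ.card_fermions, ← Ω.card_fermions, ← hI, Finset.card_map]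
  have hmem : ∀ i, σ i ∈ Ω.fermions ↔ i ∈ Λ.fermions := by intro i; simp [← hI]
  have hpart : ∀ i, Ω.part (σ i) = Λ.part i := by
    intro i
    rw [← Ω.exponent_apply, ← hs, Finsupp.mapDomain_apply σ.injective, Λ.exponent_apply]
  have hkey : sortKey Ω.fermions Ω.part ∘ σ = sortKey Λ.fermions Λ.part := by
    funext i
    simp [sortKey, hmem, hpart]
  have huniq := Tuple.unique_monotone (f := sortKey Ω.fermions Ω.part) (σ := σ) (τ := 1)
    (hkey ▸ Λ.monotone_sortKey) Ω.monotone_sortKey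
  have heq : Λ = Ω := by
    refine Superpartition.ext hm (funext fun i => ?_)
    have := congrArg (fun z => OrderDual.ofDual (ofLex z).2) (congrFun (hkey ▸ huniq) i)
    exact this
  refine ⟨heq, ?_⟩
  subst heq
  have hfix : ∀ i ∈ Λ.fermions, σ i = i := by
    intro i hi
    have h1 := Superpartition.mem_fermions.mp ((hmem i).mpr hi)
    have h2 := Superpartition.mem_fermions.mp hi
    rcases lt_trichotomy (σ i) i with h | h | h
    · exact absurd (hpart i) (Λ.strict _ _ h h2).ne'
    · exact h
    · exact absurd (hpart i) (Λ.strict _ _ h h1).ne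
  rw [inversions, Finset.card_eq_zero, Finset.filter_eq_empty_iff]
  intro p hp hlt
  rw [Finset.mem_product] at hp
  rw [hfix _ hp.1, hfix _ hp.2] at hlt
  exact hlt.1.not_gt hlt.2

theorem leadingTerm_apply {N : ℕ} (Λ : Superpartition N) (I : Finset (Fin N)) :
    leadingTerm Λ I = if I = Λ.fermions then monomial Λ.exponent 1 else 0 := by
  have h : (∏ i, X i ^ Λ.part i : MvPolynomial (Fin N) ℂ) = monomial Λ.exponent 1 := by
    rw [monomial_eq, C_1, one_mul, Finsupp.prod_fintype _ _ fun i => pow_zero _]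
    rfl
  rw [leadingTerm, h, Pi.single_apply]
  rfl

/-- The absence of a sign rules out cancellation in the sum over `σ` defining `m_Λ`: the sum counts
a set of permutations, which for `Ω = Λ` contains the identity. -/
theorem normalCoeff_permAction_leadingTerm {N : ℕ} (Ω Λ : Superpartition N)
    (σ : Equiv.Perm (Fin N)) :
    normalCoeff Ω (permAction σ (leadingTerm Λ)) =
      if Λ.fermions.map σ.toEmbedding = Ω.fermions ∧ Λ.exponent.mapDomain σ = Ω.exponent
      then 1 else 0 := by
  obtain ⟨I, hI⟩ := exists_eq_map_perm σ Ω.fermions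
  obtain ⟨s, hs⟩ : ∃ s : Fin N →₀ ℕ, s.mapDomain σ = Ω.exponent :=
    ⟨Ω.exponent.mapDomain σ.symm, by
      rw [← Finsupp.mapDomain_comp, Equiv.self_comp_symm, Finsupp.mapDomain_id]⟩
  rw [normalCoeff_apply, ← hI, ← hs, coeff_permAction, leadingTerm_apply]
  simp only [Finset.map_inj, (Finsupp.mapDomain_injective σ.injective).eq_iff]
  split_ifs with h1 h2 h2
  · obtain ⟨h3, h4⟩ := h2
    rw [coeff_monomial, if_pos h4, h1, mul_one]
    rw [h1] at hI
    rw [← h4] at hs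
    rw [(Superpartition.eq_of_perm hI hs).2, pow_zero]
  · rw [coeff_monomial, if_neg fun h => h2 ⟨h1.symm, h⟩, mul_zero]
  · exact absurd h2.1.symm h1
  · rw [coeff_zero, mul_zero]

theorem normalCoeff_superMonomial_of_ne {N : ℕ} {Ω Λ : Superpartition N} (h : Ω ≠ Λ) :
    normalCoeff Ω (superMonomial Λ) = 0 := by
  rw [superMonomial, map_smul, map_sum, Finset.sum_eq_zero, smul_zero]
  intro σ _
  rw [normalCoeff_permAction_leadingTerm, if_neg]
  exact fun h' => h (Superpartition.eq_of_perm h'.1 h'.2).1.symm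

theorem normalCoeff_superMonomial_self {N : ℕ} (Λ : Superpartition N) :
    normalCoeff Λ (superMonomial Λ) ≠ 0 := by
  rw [superMonomial, map_smul, map_sum]
  simp only [normalCoeff_permAction_leadingTerm, Finset.sum_boole]
  refine mul_ne_zero (inv_ne_zero (Nat.cast_ne_zero.mpr ?_)) (Nat.cast_ne_zero.mpr ?_)
  · exact Finset.prod_ne_zero_iff.mpr fun a _ => Nat.factorial_ne_zero _
  · refine (Finset.card_pos.mpr ⟨1, ?_⟩).ne'
    rw [Finset.mem_filter]
    refine ⟨Finset.mem_univ _, ?_, ?_⟩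
    · ext i; rw [Finset.mem_map_equiv]; rfl
    · exact Finsupp.mapDomain_id

/-- Exchanging two adjacent fermionic positions with equal exponents fixes the monomial and creates
exactly one inversion, so the coefficient equals its own negative. -/
theorem coeff_eq_zero_of_swap {N : ℕ} {F : SuperPoly N} (hF : F ∈ symmetricSubspace N)
    {I : Finset (Fin N)} {s : Fin N →₀ ℕ} {i k : Fin N} (hik : (i : ℕ) + 1 = k) (hi : i ∈ I)
    (hk : k ∈ I) (hs : s i = s k) : coeff s (F I) = 0 := by
  have hI : I.map (Equiv.swap i k).toEmbedding = I := by
    ext a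
    rw [Finset.mem_map_equiv, Equiv.symm_swap, Equiv.swap_apply_def]
    split_ifs with h1 h2 <;> simp_all
  have hs' : s.mapDomain (Equiv.swap i k) = s := by
    ext a
    rw [← Equiv.swap_apply_self i k a, Finsupp.mapDomain_apply (Equiv.swap i k).injective,
      Equiv.swap_apply_self, Equiv.swap_apply_def]
    split_ifs with h1 h2 <;> simp_all
  have hinv : inversions (Equiv.swap i k) I = 1 := by
    rw [inversions, Finset.card_eq_one]
    refine ⟨(i, k), ?_⟩
    ext ⟨p, q⟩
    simp only [Finset.mem_filter, Finset.mem_product, Finset.mem_singleton, Prod.mk.injEq,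
      Equiv.swap_apply_def, Fin.lt_def, Fin.ext_iff]
    constructor
    · rintro ⟨-, h1, h2⟩
      split_ifs at h2 <;> omega
    · rintro ⟨h1, h2⟩
      obtain rfl := Fin.ext h1
      obtain rfl := Fin.ext h2
      refine ⟨⟨hi, hk⟩, by omega, ?_⟩
      split_ifs <;> omega
  have h := coeff_permAction (Equiv.swap i k) F I s
  rw [hF i k, hI, hs', hinv, pow_one, neg_one_mul] at h
  exact self_eq_neg.mp h

theorem eq_filter_lt_card {N : ℕ} {I : Finset (Fin N)}
    (hI : ∀ i j : Fin N, i ≤ j → j ∈ I → i ∈ I) (i : Fin N) : i ∈ I ↔ (i : ℕ) < I.card := by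
  constructor
  · intro hi
    have := Finset.card_le_card (show Finset.Iic i ⊆ I from
      fun j hj => hI j i (Finset.mem_Iic.mp hj) hi)
    rw [Fin.card_Iic] at this
    omega
  · intro hlt
    by_contra hi
    have := Finset.card_le_card (show I ⊆ Finset.Iio i from fun j hj =>
      Finset.mem_Iio.mpr (lt_of_not_ge fun hle => hi (hI i j hle hj)))
    rw [Fin.card_Iio] at this
    omega

/-- Sort any occurring monomial by `sortKey`; by symmetry its coefficient changes at most by a sign.
The fermionic indices then form an initial segment and both parts decrease weakly. Strictness of the
fermionic part follows from antisymmetry. -/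
theorem exists_normalCoeff_ne_zero {N : ℕ} {F : SuperPoly N} (hF : F ∈ symmetricSubspace N)
    (h0 : F ≠ 0) : ∃ Λ, normalCoeff Λ F ≠ 0 := by
  obtain ⟨I, s, hIs⟩ : ∃ I s, coeff s (F I) ≠ 0 := by
    by_contra! h
    exact h0 (funext fun I => MvPolynomial.ext _ _ fun s => by simpa using h I s)
  set τ := Tuple.sort (sortKey I s)
  obtain ⟨I', hI'⟩ := exists_eq_map_perm τ I
  obtain ⟨s', hs'⟩ : ∃ s' : Fin N →₀ ℕ, s'.mapDomain τ = s :=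
    ⟨s.mapDomain τ.symm, by
      rw [← Finsupp.mapDomain_comp, Equiv.self_comp_symm, Finsupp.mapDomain_id]⟩
  have hne : coeff s' (F I') ≠ 0 := by
    intro hz
    have := coeff_permAction τ F I' s'
    rw [permAction_eq_self hF, hI', hs', hz, mul_zero] at this
    exact hIs this
  have hmono : Monotone (sortKey I' s') := by
    have hkey : sortKey I s ∘ τ = sortKey I' s' := by
      funext i
      simp [sortKey, ← hI', ← hs', Finsupp.mapDomain_apply τ.injective]
    rw [← hkey]
    exact Tuple.monotone_sort _
  have hle : ∀ i j, i ≤ j → (i ∈ I' ∧ j ∉ I') ∨ ((i ∈ I' ↔ j ∈ I') ∧ s' j ≤ s' i) :=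
    fun i j hij => sortKey_le_iff.mp (hmono hij)
  have hmem := eq_filter_lt_card (I := I') fun i j hij hj => by
    rcases hle i j hij with h | h
    · exact h.1
    · exact h.1.mpr hj
  have hweak : ∀ i j, i ≤ j → (i ∈ I' ↔ j ∈ I') → s' j ≤ s' i := fun i j hij hiff => by
    rcases hle i j hij with h | h
    · exact absurd (hiff.mp h.1) h.2
    · exact h.2
  refine ⟨⟨I'.card, s', by simpa using I'.card_le_univ, ?_, ?_⟩, ?_⟩
  · intro i j hij hj
    have hlt : (i : ℕ) < j := hij
    by_contra hge
    -- Equality at `i` and `j` forces equality at the adjacent positions `i` and `k = i + 1`, by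
    -- weak decrease.
    obtain ⟨k, hk⟩ : ∃ k : Fin N, (i : ℕ) + 1 = k := ⟨⟨i + 1, by omega⟩, rfl⟩
    have hi : i ∈ I' := (hmem i).mpr (by omega)
    have hj' : j ∈ I' := (hmem j).mpr hj
    have hk' : k ∈ I' := (hmem k).mpr (by omega)
    have hik := hweak i k (Fin.le_def.mpr (by omega)) ⟨fun _ => hk', fun _ => hi⟩
    have hkj := hweak k j (Fin.le_def.mpr (by omega)) ⟨fun _ => hj', fun _ => hk'⟩
    exact hne (coeff_eq_zero_of_swap hF hk hi hk' (by omega))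
  · intro i j hi hij
    have hlt : (i : ℕ) < j := hij
    exact hweak i j hij.le
      ⟨fun h => absurd ((hmem i).mp h) (by omega), fun h => absurd ((hmem j).mp h) (by omega)⟩
  · rw [normalCoeff_apply]
    convert hne using 3
    · ext i; rfl
    · ext i
      rw [Superpartition.mem_fermions, hmem]

/-! ### Monomials span the symmetric superpolynomials -/

theorem linearIndependent_superMonomial (N : ℕ) :
    LinearIndependent ℂ (superMonomial : Superpartition N → SuperPoly N) := by
  rw [linearIndependent_iff']
  intro S g hg Λ hΛ
  have h := congrArg (normalCoeff Λ) hg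
  rw [map_sum, map_zero, Finset.sum_eq_single Λ] at h
  · rw [map_smul, smul_eq_mul] at h
    exact (mul_eq_zero.mp h).resolve_right (normalCoeff_superMonomial_self Λ)
  · intro Ω _ hne
    rw [map_smul, normalCoeff_superMonomial_of_ne hne.symm, smul_zero]
  · exact fun h => absurd hΛ h

theorem normalCoeff_support_finite {N : ℕ} (F : SuperPoly N) :
    {Λ : Superpartition N | normalCoeff Λ F ≠ 0}.Finite := by
  have hinj : Function.Injective fun Λ : Superpartition N => (Λ.fermions, Λ.exponent) := by
    intro Ω Λ h
    obtain ⟨h1, h2⟩ := Prod.mk.inj h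
    refine Superpartition.ext ?_ (Finsupp.equivFunOnFinite.symm.injective h2)
    rw [← Ω.card_fermions, h1, Λ.card_fermions]
  refine Set.Finite.of_finite_image (f := fun Λ : Superpartition N => (Λ.fermions, Λ.exponent))
    (((Finset.univ ×ˢ Finset.univ.biUnion fun I => (F I).support :
      Finset (Finset (Fin N) × (Fin N →₀ ℕ)))).finite_toSet.subset ?_) hinj.injOn
  rintro _ ⟨Λ, hΛ, rfl⟩
  simp only [Finset.coe_product, Set.mem_prod, Finset.mem_coe, Finset.mem_univ, true_and,
    Finset.mem_biUnion, mem_support_iff]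
  exact ⟨Λ.fermions, hΛ⟩

/-- The combination of the `m_Λ` with the same normal coefficients as `F` must be `F`. Recording
which `m_Λ` occur keeps the degree information needed later. -/
theorem mem_span_superMonomial {N : ℕ} {F : SuperPoly N} (hF : F ∈ symmetricSubspace N) :
    F ∈ Submodule.span ℂ (superMonomial '' {Λ : Superpartition N | normalCoeff Λ F ≠ 0}) := by
  set S := (normalCoeff_support_finite F).toFinset with hS
  have hmem : ∀ Λ, Λ ∈ S ↔ normalCoeff Λ F ≠ 0 := fun Λ => by simp [hS]
  set G : SuperPoly N :=
    ∑ Λ ∈ S, (normalCoeff Λ F / normalCoeff Λ (superMonomial Λ)) • superMonomial Λ with hG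
  have hGmem : G ∈ Submodule.span ℂ
      (superMonomial '' {Λ : Superpartition N | normalCoeff Λ F ≠ 0}) :=
    Submodule.sum_mem _ fun Λ hΛ => Submodule.smul_mem _ _
      (Submodule.subset_span ⟨Λ, (hmem Λ).mp hΛ, rfl⟩)
  have hGsymm : G ∈ symmetricSubspace N :=
    Submodule.sum_mem _ fun Λ _ => Submodule.smul_mem _ _ (superMonomial_mem Λ)
  have hcoeff : ∀ Λ, normalCoeff Λ (F - G) = 0 := by
    intro Λ
    rw [map_sub, hG, map_sum, sub_eq_zero]
    by_cases hΛ : Λ ∈ S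
    · rw [Finset.sum_eq_single_of_mem Λ hΛ fun Ω _ hne => by
        rw [map_smul, normalCoeff_superMonomial_of_ne hne.symm, smul_zero], map_smul, smul_eq_mul,
        div_mul_cancel₀ _ (normalCoeff_superMonomial_self Λ)]
    · rw [Finset.sum_eq_zero fun Ω hΩ => by
        rw [map_smul, normalCoeff_superMonomial_of_ne (show Λ ≠ Ω from fun e => hΛ (e ▸ hΩ)),
          smul_zero]]
      simpa [hmem] using hΛ
  have hFG : F = G := by
    by_contra hne
    obtain ⟨Λ, hΛ⟩ := exists_normalCoeff_ne_zero (Submodule.sub_mem _ hF hGsymm)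
      (sub_ne_zero.mpr hne)
    exact hΛ (hcoeff Λ)
  rw [hFG] at hGmem ⊢
  exact hGmem

theorem euler_permAction {N : ℕ} (σ : Equiv.Perm (Fin N)) (F : SuperPoly N) :
    onSuper (euler N) (permAction σ F) = permAction σ (onSuper (euler N) F) := by
  funext J
  obtain ⟨I, rfl⟩ := exists_eq_map_perm σ J
  rw [onSuper_apply, permAction_apply_map, permAction_apply_map, onSuper_apply, map_smul,
    euler_rename]

theorem euler_superMonomial {N : ℕ} (Λ : Superpartition N) :
    onSuper (euler N) (superMonomial Λ) = (Λ.degree : ℂ) • superMonomial Λ := by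
  have h : onSuper (euler N) (leadingTerm Λ) = (Λ.degree : ℂ) • leadingTerm Λ := by
    funext I
    rw [onSuper_apply, Pi.smul_apply, leadingTerm_apply]
    split_ifs
    · exact euler_monomial _ _
    · rw [map_zero, smul_zero]
  rw [superMonomial, map_smul, map_sum, smul_comm]
  congr 1
  simp only [euler_permAction, h, map_smul, Finset.smul_sum]

/-! ### Unitriangular families -/

section Triangular

/-- The inverse of a unitriangular change of family is unitriangular, by induction on the rank `ρ`.
It serves both the dominance order and the `u`-order. -/
theorem sub_mem_span_of_triangular {ι K V : Type*} [Field K] [AddCommGroup V] [Module K V]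
    {v w : ι → V} {r : ι → ι → Prop} {ρ : ι → ℕ} (hr : ∀ i j k, r i j → r j k → r i k)
    (hρ : ∀ i j, r i j → ρ i < ρ j)
    (h : ∀ i, w i - v i ∈ Submodule.span K (v '' {j | r j i})) (i : ι) :
    v i - w i ∈ Submodule.span K (w '' {j | r j i}) := by
  induction hn : ρ i using Nat.strong_induction_on generalizing i with
  | _ n ih =>
    subst hn
    have hle : Submodule.span K (v '' {j | r j i}) ≤ Submodule.span K (w '' {j | r j i}) := by
      rw [Submodule.span_le]
      rintro _ ⟨j, hj, rfl⟩
      have h1 : v j - w j ∈ Submodule.span K (w '' {j | r j i}) :=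
        Submodule.span_mono (Set.image_mono fun k hk => hr k j i hk hj)
          (ih (ρ j) (hρ j i hj) j rfl)
      have h2 : w j ∈ Submodule.span K (w '' {j | r j i}) := Submodule.subset_span ⟨j, hj, rfl⟩
      simpa using Submodule.add_mem _ h1 h2
    rw [← neg_sub]
    exact Submodule.neg_mem _ (hle (h i))

theorem linearIndependent_of_triangular {ι K V : Type*} [Field K] [AddCommGroup V] [Module K V]
    {v w : ι → V} {r : ι → ι → Prop} {ρ : ι → ℕ} (hρ : ∀ i j, r i j → ρ i < ρ j)
    (h : ∀ i, w i - v i ∈ Submodule.span K (v '' {j | r j i})) (hv : LinearIndependent K v) :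
    LinearIndependent K w := by
  rw [linearIndependent_iff']
  intro S g hg
  classical
  by_contra! hne
  obtain ⟨i₀, hi₀, hgi₀⟩ := hne
  -- At an index `i` of maximal rank in the relation, `v i` cannot enter any of the lower-order
  -- corrections. Hence the relation expresses `v i` through the other `v k`.
  obtain ⟨i, hi, hmax⟩ := Finset.exists_max_image (S.filter fun j => g j ≠ 0) ρ
    ⟨i₀, Finset.mem_filter.mpr ⟨hi₀, hgi₀⟩⟩
  obtain ⟨hiS, hgi⟩ := Finset.mem_filter.mp hi
  have hlow : ∀ j ∈ S, g j ≠ 0 →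
      w j - v j ∈ Submodule.span K (v '' {k | k ≠ i}) := by
    intro j hj hgj
    refine Submodule.span_mono (Set.image_mono ?_) (h j)
    rintro k hk rfl
    exact (hρ k j hk).not_ge (hmax j (Finset.mem_filter.mpr ⟨hj, hgj⟩))
  have hrest : ∑ j ∈ S.erase i, g j • w j ∈ Submodule.span K (v '' {k | k ≠ i}) := by
    refine Submodule.sum_mem _ fun j hj => ?_
    by_cases hgj : g j = 0
    · rw [hgj, zero_smul]
      exact Submodule.zero_mem _
    · have h1 := hlow j (Finset.mem_of_mem_erase hj) hgj
      have h2 : v j ∈ Submodule.span K (v '' {k | k ≠ i}) :=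
        Submodule.subset_span ⟨j, Finset.ne_of_mem_erase hj, rfl⟩
      have h3 := Submodule.add_mem _ h1 h2
      rw [sub_add_cancel] at h3
      exact Submodule.smul_mem _ _ h3
  have hw : w i ∈ Submodule.span K (v '' {k | k ≠ i}) := by
    rw [← Finset.add_sum_erase _ _ hiS] at hg
    rw [eq_neg_of_add_eq_zero_right hg, Submodule.neg_mem_iff] at hrest
    exact (Submodule.smul_mem_iff _ hgi).mp hrest
  have hvi : v i ∈ Submodule.span K (v '' {k | k ≠ i}) := by
    simpa using Submodule.sub_mem _ hw (hlow i hiS hgi)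
  exact hv.notMem_span_image (by simp) hvi

end Triangular

/-! ### The Jack basis -/

/-- The number of superpartitions strictly below `Λ` is the rank used for the dominance order. -/
theorem ncard_dominanceLT_lt {N : ℕ} (Ω Λ : Superpartition N) (h : dominanceLT Ω Λ) :
    {Γ | dominanceLT Γ Ω}.ncard < {Γ | dominanceLT Γ Λ}.ncard :=
  Set.ncard_lt_ncard ⟨fun _ hΘ => dominanceLT.trans hΘ h, fun hs => (hs h).2 rfl⟩
    (dominanceLT_finite Λ)

theorem superMonomial_sub_jack_mem {N : ℕ} (β : ℕ) (Λ : Superpartition N) :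
    superMonomial Λ - jack β Λ ∈ Submodule.span ℂ (jack β '' {Ω | dominanceLT Ω Λ}) :=
  sub_mem_span_of_triangular (r := dominanceLT) (fun _ _ _ => dominanceLT.trans)
    ncard_dominanceLT_lt (jack_sub_mem β) Λ

theorem linearIndependent_jack (N β : ℕ) :
    LinearIndependent ℂ (jack β : Superpartition N → SuperPoly N) :=
  linearIndependent_of_triangular (r := dominanceLT) ncard_dominanceLT_lt (jack_sub_mem β)
    (linearIndependent_superMonomial N)

theorem jack_mem {N : ℕ} (β : ℕ) (Λ : Superpartition N) : jack β Λ ∈ symmetricSubspace N := by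
  have hle : Submodule.span ℂ (superMonomial '' {Ω : Superpartition N | dominanceLT Ω Λ}) ≤
      symmetricSubspace N := by
    rw [Submodule.span_le]
    rintro _ ⟨Ω, _, rfl⟩
    exact superMonomial_mem Ω
  have := Submodule.add_mem _ (hle (jack_sub_mem β Λ)) (superMonomial_mem Λ)
  rwa [sub_add_cancel] at this

theorem euler_jack {N : ℕ} (β : ℕ) (Λ : Superpartition N) :
    onSuper (euler N) (jack β Λ) = (Λ.degree : ℂ) • jack β Λ := by
  have hle : Submodule.span ℂ (superMonomial '' {Ω : Superpartition N | dominanceLT Ω Λ}) ≤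
      Module.End.eigenspace (onSuper (euler N)) (Λ.degree : ℂ) := by
    rw [Submodule.span_le]
    rintro _ ⟨Ω, hΩ, rfl⟩
    rw [SetLike.mem_coe, Module.End.mem_eigenspace_iff, euler_superMonomial, hΩ.1.2.1]
  have := Submodule.add_mem _ (hle (jack_sub_mem β Λ))
    (Module.End.mem_eigenspace_iff.mpr (euler_superMonomial Λ))
  rw [sub_add_cancel] at this
  exact Module.End.mem_eigenspace_iff.mp this

theorem superMonomial_mem_span_jack {N : ℕ} (β : ℕ) (Λ : Superpartition N) :
    superMonomial Λ ∈ Submodule.span ℂ (jack β '' {Ω | Ω.degree = Λ.degree}) := by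
  have h1 : superMonomial Λ - jack β Λ ∈
      Submodule.span ℂ (jack β '' {Ω | Ω.degree = Λ.degree}) :=
    Submodule.span_mono (Set.image_mono fun Ω (hΩ : dominanceLT Ω Λ) => hΩ.1.2.1)
      (superMonomial_sub_jack_mem β Λ)
  have h2 : jack β Λ ∈ Submodule.span ℂ (jack β '' {Ω | Ω.degree = Λ.degree}) :=
    Submodule.subset_span ⟨Λ, rfl, rfl⟩
  simpa using Submodule.add_mem _ h1 h2

theorem span_jack (N β : ℕ) :
    Submodule.span ℂ (Set.range (jack β : Superpartition N → SuperPoly N)) =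
      symmetricSubspace N := by
  refine le_antisymm (Submodule.span_le.mpr ?_) fun F hF => ?_
  · rintro _ ⟨Λ, rfl⟩
    exact jack_mem β Λ
  · refine Submodule.span_le.mpr ?_ (mem_span_superMonomial hF)
    rintro _ ⟨Λ, _, rfl⟩
    exact Submodule.span_mono (Set.image_subset_range _ _) (superMonomial_mem_span_jack β Λ)

/-- Normal coefficients outside degree `c` vanish, and passing from `m_Λ` to Jack superpolynomials
preserves the degree. -/
theorem mem_span_jack_of_euler {N : ℕ} (β : ℕ) {F : SuperPoly N} (hF : F ∈ symmetricSubspace N)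
    {c : ℂ} (hc : onSuper (euler N) F = c • F) :
    F ∈ Submodule.span ℂ (jack β '' {Ω | (Ω.degree : ℂ) = c}) := by
  refine Submodule.span_le.mpr ?_ (mem_span_superMonomial hF)
  rintro _ ⟨Λ, hΛ, rfl⟩
  have hdeg : (Λ.degree : ℂ) = c := by
    by_contra hne
    exact hΛ (coeff_eq_zero_of_euler hc _ _ hne)
  refine Submodule.span_mono (Set.image_mono fun Ω hΩ => ?_) (superMonomial_mem_span_jack β Λ)
  rw [Set.mem_ofPred_eq] at hΩ ⊢
  rw [hΩ, hdeg]

/-! ### The generalized Hermite basis -/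

theorem uLT.degree_lt {N : ℕ} (Ω Λ : Superpartition N) (h : uLT Ω Λ) : Ω.degree < Λ.degree := by
  obtain ⟨n, hn, h'⟩ := h.1.resolve_left h.2
  omega

theorem uLT.trans {N : ℕ} (Γ Ω Λ : Superpartition N) (h1 : uLT Γ Ω) (h2 : uLT Ω Λ) :
    uLT Γ Λ := by
  obtain ⟨n, hn, hn'⟩ := h1.1.resolve_left h1.2
  obtain ⟨k, hk, hk'⟩ := h2.1.resolve_left h2.2
  refine ⟨Or.inr ⟨n + k, by omega, by omega⟩, ?_⟩
  rintro rfl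
  omega

theorem hermite_sub_jack_mem {N : ℕ} (β : ℕ) (ω : ℝ) (Λ : Superpartition N) :
    hermite β ω Λ - jack β Λ ∈ Submodule.span ℂ (jack β '' {Ω | uLT Ω Λ}) := by
  rw [hermite, expLaplacian_eq_sum β ω (euler_jack β Λ), Finset.sum_range_succ']
  simp only [Nat.factorial_zero, Nat.cast_one, inv_one, pow_zero, one_mul, one_smul,
    Module.End.one_apply, add_sub_cancel_right]
  -- The zeroth term `J_Λ` has cancelled; the term of index `n + 1` has degree `|Λ| - 2(n + 1)`.
  refine Submodule.sum_mem _ fun n _ => Submodule.smul_mem _ _ ?_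
  refine Submodule.span_mono (Set.image_mono fun Ω hΩ => ?_)
    (mem_span_jack_of_euler β (laplacian_pow_mem β (jack_mem β Λ) (n + 1))
      (euler_laplacian_pow β (euler_jack β Λ) (n + 1)))
  have h : Ω.degree + 2 * (n + 1) = Λ.degree := by
    have := eq_sub_iff_add_eq.mp (show (Ω.degree : ℂ) = Λ.degree - 2 * ((n + 1 : ℕ) : ℂ) from hΩ)
    exact_mod_cast this
  refine ⟨Or.inr ⟨n + 1, by omega, h⟩, ?_⟩
  rintro rfl
  omega

theorem jack_sub_hermite_mem {N : ℕ} (β : ℕ) (ω : ℝ) (Λ : Superpartition N) :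
    jack β Λ - hermite β ω Λ ∈ Submodule.span ℂ (hermite β ω '' {Ω | uLT Ω Λ}) :=
  sub_mem_span_of_triangular uLT.trans uLT.degree_lt (hermite_sub_jack_mem β ω) Λ

theorem hermite_mem {N : ℕ} (β : ℕ) (ω : ℝ) (Λ : Superpartition N) :
    hermite β ω Λ ∈ symmetricSubspace N := by
  rw [← span_jack N β]
  have h1 := Submodule.span_mono (Set.image_subset_range _ _) (hermite_sub_jack_mem β ω Λ)
  have h2 : jack β Λ ∈ Submodule.span ℂ (Set.range (jack β : Superpartition N → _)) :=
    Submodule.subset_span ⟨Λ, rfl⟩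
  simpa using Submodule.add_mem _ h1 h2

theorem span_hermite (N β : ℕ) (ω : ℝ) :
    Submodule.span ℂ (Set.range (hermite β ω : Superpartition N → SuperPoly N)) =
      symmetricSubspace N := by
  refine le_antisymm (Submodule.span_le.mpr ?_) ?_
  · rintro _ ⟨Λ, rfl⟩
    exact hermite_mem β ω Λ
  · rw [← span_jack N β, Submodule.span_le]
    rintro _ ⟨Λ, rfl⟩
    have h1 := Submodule.span_mono (Set.image_subset_range _ _) (jack_sub_hermite_mem β ω Λ)
    have h2 : hermite β ω Λ ∈ Submodule.span ℂ (Set.range (hermite β ω : Superpartition N → _)) :=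
      Submodule.subset_span ⟨Λ, rfl⟩
    simpa using Submodule.add_mem _ h1 h2

theorem hamiltonian_hermite {N : ℕ} (β : ℕ) {ω : ℝ} (hω : ω ≠ 0) (Λ : Superpartition N) :
    hamiltonian N β ω (hermite β ω Λ) = (Λ.degree : ℂ) • hermite β ω Λ :=
  hamiltonian_expLaplacian β hω (euler_jack β Λ)

theorem isTriangularEigenbasis_hermite (N β : ℕ) {ω : ℝ} (hω : ω ≠ 0) :
    IsTriangularEigenbasis β ω fun Λ : Superpartition N => hermite β ω Λ where
  linearIndependent := linearIndependent_of_triangular uLT.degree_lt (hermite_sub_jack_mem β ω)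
    (linearIndependent_jack N β)
  span_eq := span_hermite N β ω
  eigen := hamiltonian_hermite β hω
  triangular Λ := by
    obtain ⟨w, hw, hsum⟩ := (Finsupp.mem_span_image_iff_linearCombination ℂ).mp
      (hermite_sub_jack_mem β ω Λ)
    refine ⟨w, fun Ω hΩ => (Finsupp.mem_supported ℂ w).mp hw hΩ, ?_⟩
    rw [Finsupp.linearCombination_apply] at hsum
    rw [hsum, add_sub_cancel]

theorem IsTriangularEigenbasis.eq_hermite {N β : ℕ} {ω : ℝ} (hω : ω ≠ 0)
    {F : Superpartition N → SuperPoly N} (hF : IsTriangularEigenbasis β ω F)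
    (Λ : Superpartition N) : F Λ = hermite β ω Λ := by
  obtain ⟨w, hw, hsum⟩ := hF.triangular Λ
  have h1 : F Λ - jack β Λ ∈ Submodule.span ℂ (jack β '' {Ω | uLT Ω Λ}) := by
    rw [hsum, add_sub_cancel_left]
    exact Submodule.sum_mem _ fun Ω hΩ => Submodule.smul_mem _ _
      (Submodule.subset_span ⟨Ω, hw Ω hΩ, rfl⟩)
  have h2 : F Λ - hermite β ω Λ ∈ Submodule.span ℂ (jack β '' {Ω | uLT Ω Λ}) := by
    simpa using Submodule.sub_mem _ h1 (hermite_sub_jack_mem β ω Λ)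
  -- The `J_Ω` need not be eigenvectors, so they are expanded in the `J_Γ^ω` with `Γ ≤_u Ω`, all of
  -- eigenvalue below `|Λ|`.
  have hle : Submodule.span ℂ (jack β '' {Ω | uLT Ω Λ}) ≤
      ⨆ c, ⨆ (_ : c ≠ (Λ.degree : ℂ)), Module.End.eigenspace (hamiltonian N β ω) c := by
    have hmem : ∀ Ω, uLT Ω Λ → hermite β ω Ω ∈
        ⨆ c, ⨆ (_ : c ≠ (Λ.degree : ℂ)), Module.End.eigenspace (hamiltonian N β ω) c :=
      fun Ω hΩ => Submodule.mem_iSup_of_mem (Ω.degree : ℂ) (Submodule.mem_iSup_of_mem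
        (Nat.cast_injective.ne (uLT.degree_lt Ω Λ hΩ).ne)
        (Module.End.mem_eigenspace_iff.mpr (hamiltonian_hermite β hω Ω)))
    rw [Submodule.span_le]
    rintro _ ⟨Ω, hΩ, rfl⟩
    have h3 : jack β Ω - hermite β ω Ω ∈ _ :=
      Submodule.span_le.mpr (by
        rintro _ ⟨Γ, hΓ, rfl⟩
        exact hmem Γ (uLT.trans Γ Ω Λ hΓ hΩ)) (jack_sub_hermite_mem β ω Ω)
    have h4 := Submodule.add_mem _ h3 (hmem Ω hΩ)
    rwa [sub_add_cancel] at h4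
  have heig : F Λ - hermite β ω Λ ∈
      Module.End.eigenspace (hamiltonian N β ω) (Λ.degree : ℂ) :=
    Submodule.sub_mem _ (Module.End.mem_eigenspace_iff.mpr (hF.eigen Λ))
      (Module.End.mem_eigenspace_iff.mpr (hamiltonian_hermite β hω Λ))
  exact sub_eq_zero.mp (Submodule.disjoint_def.mp
    (Module.End.eigenspaces_iSupIndep (hamiltonian N β ω) (Λ.degree : ℂ)) _ heig (hle h2))

end SuperCMS

theorem mainTheorem2 (N β : ℕ) (hβ : 0 < β) (ω : ℝ) (hω : 0 < ω) :
    SuperCMS.IsTriangularEigenbasis β ω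
        (fun Λ : SuperCMS.Superpartition N => SuperCMS.hermite β ω Λ) ∧
      ∀ F : SuperCMS.Superpartition N → SuperCMS.SuperPoly N,
        SuperCMS.IsTriangularEigenbasis β ω F → ∀ Λ, F Λ = SuperCMS.hermite β ω Λ :=
  ⟨SuperCMS.isTriangularEigenbasis_hermite N β hω.ne',
    fun _ hF Λ => hF.eq_hermite hω.ne' Λ⟩
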